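/- Let $n\ge 2$, $B\ge 2$, $p, T\ge 0$ be integers. Arrange nodes $1,\dots,n$ in the $B$-ary tree whose nodes are numbered layer by layer from the root $1$: the children of $j$ are the numbers $i\le n$ with $Bj+2-B\le i\le Bj+1$. In the pull tree every node sends to its children, in the push tree every non-root node sends to its parent, and in both trees node $1$ also sends to itself; $\mathcal N^{in}_{\mathcal R,i}$ and $\mathcal N^{in}_{\mathcal C,i}$ denote the sets of nodes that send to $i$ in the pull and push tree, respectively. Let $d=\lfloor\log_B n\rfloor$ and assume $d\ge 1$; alternatively, let $d$ be the exact depth of the tree, that is, the integer with $\frac{B^d-1}{B-1}<n\le\frac{B^{d+1}-1}{B-1}$ (the two agree for $B=2$). The result holds for both choices of $d$. Let $L,\sigma>0$, let $f_1,\dots,f_n:\mathbb R^p\to\mathbb R$ be bounded below and differentiable with $L$-Lipschitz gradients, and put $f=\frac1n\sum_i f_i$, $f^*=\inf f$. For each $i$ let $\mathcal D_i$ be a probability law and $g_i(x,\xi)$ a (jointly measurable) stochastic gradient with $\mathbb E_{\xi\sim\mathcal D_i}[g_i(x,\xi)]=\nabla f_i(x)$ and $\mathbb E_{\xi\sim\mathcal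 D_i}\|g_i(x,\xi)-\nabla f_i(x)\|^2\le\sigma^2$ for all $x\in\mathbb R^p$. Let $\xi_i^{(t)}\sim\mathcal D_i$ ($t\ge 0$, $1\le i\le n$) be independent. For a deterministic $x^{(0)}\in\mathbb R^p$, B-ary Tree Push-Pull (BTPP) is the recursion $x_i^{(0)}=x^{(0)}$, $y_i^{(0)}=g_i(x_i^{(0)},\xi_i^{(0)})$, $$x_i^{(t+1)}=\sum_{j\in\mathcal N^{in}_{\mathcal R,i}}\bigl(x_j^{(t)}-\gamma y_j^{(t)}\bigr),\qquad y_i^{(t+1)}=\sum_{j\in\mathcal N^{in}_{\mathcal C,i}}y_j^{(t)}+g_i(x_i^{(t+1)},\xi_i^{(t+1)})-g_i(x_i^{(t)},\xi_i^{(t)}).$$ Put $\Delta_f=f(x^{(0)})-f^*$, $\|\nabla F(X^{(0)})\|_F^2=\sum_i\|\nabla f_i(x^{(0)})\|^2$ and $$\gamma=\min\Bigl\{\Bigl(\tfrac{\Delta_f}{3\sigma^2Ln(T+1)}\Bigr)^{1/2},\ \Bigl(\tfrac{\Delta_f}{1500n^2d^6\sigma^2L^2(T+1)}\Bigr)^{1/3},\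 \tfrac1{100nd^3L}\Bigr\}.$$ Then the expectations below are finite and $$\frac1{T+1}\sum_{t=0}^{T}\mathbb E\|\nabla f(x_1^{(t)})\|^2\le\frac{32\sqrt{\Delta_f\sigma^2L}}{\sqrt{n(T+1)}}+\frac{240d^2(\sigma^2L^2\Delta_f^2)^{1/3}}{(\sqrt n\,(T+1))^{2/3}}+\frac{800d^3L\Delta_f}{T+1}+\frac{\|\nabla F(X^{(0)})\|_F^2}{n(T+1)}.$$ Consequently the transient time is $O(n\log^{12}n)=\tilde O(n)$: for all constants $\Delta_f,\sigma,L,c>0$ and $M\ge 0$ there is a $K>0$, independent of $B,n,d,T$, such that whenever $\|\nabla F(X^{(0)})\|_F^2\le Mn$ and $T\ge c\,n(\log n)^{12}$, the sum of the last three terms of this bound is at most $K$ times its first term. -/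

import Mathlib

open MeasureTheory ProbabilityTheory

namespace BTPP

/-- Edge relation of the pull tree on `n` nodes: node `j` sends to node `i`. Nodes are numbered
from `0`, layer by layer, with root `0`; so `Fin` index `i` is the node called `i + 1` in
one-based numbering. The children of `j` are `B * j + 1, ..., B * j + B` (those that are `< n`),
and the root has a self-loop. -/
def PullEdge (B : ℕ) {n : ℕ} (j i : Fin n) : Prop :=
  (B * (j : ℕ) + 1 ≤ (i : ℕ) ∧ (i : ℕ) ≤ B * (j : ℕ) + B) ∨ ((i : ℕ) = 0 ∧ (j : ℕ) = 0)

/-- Edge relation of the push tree: all edges of the pull tree reversed. -/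
def PushEdge (B : ℕ) {n : ℕ} (j i : Fin n) : Prop := PullEdge B i j

instance (B : ℕ) {n : ℕ} (j i : Fin n) : Decidable (PullEdge B j i) := by
  unfold PullEdge; infer_instance

instance (B : ℕ) {n : ℕ} (j i : Fin n) : Decidable (PushEdge B j i) := by
  unfold PushEdge; infer_instance

/-- In-neighbours of node `i` in the pull tree. -/
def pullIn (B : ℕ) {n : ℕ} (i : Fin n) : Finset (Fin n) :=
  Finset.univ.filter fun j => PullEdge B j i

/-- In-neighbours of node `i` in the push tree. -/
def pushIn (B : ℕ) {n : ℕ} (i : Fin n) : Finset (Fin n) :=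
  Finset.univ.filter fun j => PushEdge B j i

/-- `d` is the depth (distance from the root to the last layer) of the `B`-ary tree with `n`
nodes: the layers `0, ..., d - 1` do not hold all `n` nodes, the layers `0, ..., d` do. -/
def IsTreeDepth (B n d : ℕ) : Prop :=
  ∑ k ∈ Finset.range d, B ^ k < n ∧ n ≤ ∑ k ∈ Finset.range (d + 1), B ^ k

/-- The iterates `(X t, Y t)` of B-ary Tree Push-Pull along a sample path `s`, where `s t i` is
the sample that agent `i` draws for iteration `t`, `g i` is the stochastic gradient of agent `i`,
`γ` the stepsize and `x₀` the common initial point. -/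
noncomputable def iterates {E : Type*} [AddCommGroup E] [Module ℝ E] {n : ℕ} {Ξ : Fin n → Type*}
    (B : ℕ) (γ : ℝ) (x₀ : E) (g : ∀ i, E → Ξ i → E) (s : ℕ → ∀ i, Ξ i) :
    ℕ → (Fin n → E) × (Fin n → E)
  | 0 => (fun _ => x₀, fun i => g i x₀ (s 0 i))
  | t + 1 =>
    let X := (iterates B γ x₀ g s t).1
    let Y := (iterates B γ x₀ g s t).2
    let X' : Fin n → E := fun i => ∑ j ∈ pullIn B i, (X j - γ • Y j)
    (X', fun i => ∑ j ∈ pushIn B i, Y j + g i (X' i) (s (t + 1) i) - g i (X i) (s t i))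

/-- The global objective `f = (1/n) ∑ i, f i`. -/
noncomputable def objective {E : Type*} {n : ℕ} (f : Fin n → E → ℝ) (x : E) : ℝ :=
  (1 / (n : ℝ)) * ∑ i, f i x

/-- The initial gap `f(x₀) - inf f`. -/
noncomputable def initialGap {E : Type*} {n : ℕ} (f : Fin n → E → ℝ) (x₀ : E) : ℝ :=
  objective f x₀ - ⨅ x, objective f x

/-- `h` is bounded below and differentiable, with `L`-Lipschitz gradient. -/
def IsSmoothBddBelow {p : ℕ} (L : ℝ) (h : EuclideanSpace ℝ (Fin p) → ℝ) : Prop :=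
  BddBelow (Set.range h) ∧ Differentiable ℝ h ∧
    ∀ x x', ‖gradient h x - gradient h x'‖ ≤ L * ‖x - x'‖

/-- For a sample with law `D`, `g x` is an unbiased estimator of the gradient of `h` at `x`, with
variance at most `σ²`, for every `x`. -/
def IsUnbiasedOracle {p : ℕ} {S : Type*} [MeasurableSpace S] (D : Measure S) (σ : ℝ)
    (h : EuclideanSpace ℝ (Fin p) → ℝ)
    (g : EuclideanSpace ℝ (Fin p) → S → EuclideanSpace ℝ (Fin p)) : Prop :=
  Measurable (Function.uncurry g) ∧
    ∀ x, Integrable (g x) D ∧ ∫ s, g x s ∂D = gradient h x ∧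
      Integrable (fun s => ‖g x s - gradient h x‖ ^ 2) D ∧
      ∫ s, ‖g x s - gradient h x‖ ^ 2 ∂D ≤ σ ^ 2

/-- The stepsize. -/
noncomputable def stepsize (Δ σ L : ℝ) (n d T : ℕ) : ℝ :=
  min (min ((Δ / (3 * σ ^ 2 * L * n * (T + 1))) ^ ((1 : ℝ) / 2))
      ((Δ / (1500 * (n : ℝ) ^ 2 * (d : ℝ) ^ 6 * σ ^ 2 * L ^ 2 * (T + 1))) ^ ((1 : ℝ) / 3)))
    (1 / (100 * n * (d : ℝ) ^ 3 * L))

/-- The leading term of the rate, of order `1 / √(n (T + 1))`. -/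
noncomputable def leadingTerm (Δ σ L : ℝ) (n T : ℕ) : ℝ :=
  32 * √(Δ * σ ^ 2 * L) / √(n * (T + 1))

/-- The remaining terms of the rate; `Γ` stands for `‖∇F(X⁰)‖²` in Frobenius norm. -/
noncomputable def remainingTerms (Δ σ L Γ : ℝ) (n d T : ℕ) : ℝ :=
  240 * (d : ℝ) ^ 2 * (σ ^ 2 * L ^ 2 * Δ ^ 2) ^ ((1 : ℝ) / 3)
      / (√n * (T + 1)) ^ ((2 : ℝ) / 3)
    + 800 * (d : ℝ) ^ 3 * L * Δ / (T + 1)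
    + Γ / (n * (T + 1))

end BTPP

namespace BTPP

/-! ### Rooted trees given by a parent map -/

/-! The proof reads every quantity on the clock of the root. A sample drawn by node `j` at time `t`
reaches the root at time `t + dep j`, and the state of `j` relevant to an arrival at time `m` is its
state at time `m - dep j` (`arrival`, `aligned`). On this clock the root performs gradient descent
along the sum of all arrivals, with each gradient evaluated at a displaced point: at the root the
tracking variable is exactly that sum, elsewhere it is the sum of the latest changes of the arrivals
from the subtree (`IsPushPull.y_eq`). Each tree edge costs two units of lag, so the displacement of
a node from the root is `γ` times a combination, with coefficients in `[0, 1]` that depend on the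
tree alone, of arrivals over a window of length twice its depth (`exists_displacement_coeff`).

Along one sample path this yields four coupled inequalities, for the arriving gradients, their
changes, the displacements and the decrease of the objective. Gradients still on their way in the
first steps contribute only multiples of the initial gradients and of the initial gap, together with
terms of higher order in `γ`. As `γ L n d ^ 3 ≤ 1 / 100`, the feedback among the inequalities is a
contraction and can be absorbed (`combine_path_bounds`, `IsDelayedDescent.sum_sq_norm_gradient_le`).
What is left is the initial data, noise energies and the inner products of root gradients with
arriving noise.

In expectation these inner products vanish: a state depends only on samples that arrive earlier than
the current sample of its node (`measurable_state`). Ordered by arrival time, the noises are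
therefore pairwise orthogonal, and a window of `R` lags has noise energy linear in `R` and in `n`,
where Cauchy-Schwarz alone would give squares. The resulting bound consists of `Δ / γ`, initial
terms, and noise of orders `γ` and `γ ^ 2`; the three entries of the stepsize balance these
(`rate_of_stepsize`). The transient time follows from `d ≤ 3 log n` by comparing powers of the rate
terms (`remainingTerms_le`). -/

/-- `par` is the parent map and `dep` the depth function of a tree with root `r`, where the root
is its own parent. -/
structure IsRootedTree {ι : Type*} (r : ι) (par : ι → ι) (dep : ι → ℕ) : Prop where
  par_root : par r = r
  dep_root : dep r = 0
  dep_succ : ∀ i, i ≠ r → dep i = dep (par i) + 1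

/-- Node `i` lies on the path from node `j` to the root. -/
def IsAnc {ι : Type*} (par : ι → ι) (dep : ι → ℕ) (j i : ι) : Prop :=
  dep i ≤ dep j ∧ par^[dep j - dep i] j = i

namespace IsRootedTree

variable {ι : Type*} {r : ι} {par : ι → ι} {dep : ι → ℕ}

theorem dep_eq_zero_iff (h : IsRootedTree r par dep) {i : ι} : dep i = 0 ↔ i = r := by
  refine ⟨fun hi => ?_, fun hi => hi ▸ h.dep_root⟩
  by_contra hne
  have := h.dep_succ i hne
  omega

theorem dep_pos (h : IsRootedTree r par dep) {i : ι} (hi : i ≠ r) : 0 < dep i :=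
  Nat.pos_of_ne_zero fun h0 => hi (h.dep_eq_zero_iff.1 h0)

theorem dep_iterate (h : IsRootedTree r par dep) (j : ι) (k : ℕ) :
    dep (par^[k] j) = dep j - k := by
  induction k with
  | zero => simp
  | succ k ih =>
    rw [Function.iterate_succ_apply']
    by_cases hr : par^[k] j = r
    · rw [hr, h.par_root, h.dep_root]
      rw [hr, h.dep_root] at ih
      omega
    · have := h.dep_succ _ hr
      omega

theorem iterate_dep (h : IsRootedTree r par dep) (j : ι) : par^[dep j] j = r := by
  rw [← h.dep_eq_zero_iff, h.dep_iterate]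
  omega

theorem isAnc_root (h : IsRootedTree r par dep) (j : ι) : IsAnc par dep j r := by
  refine ⟨by simp [h.dep_root], ?_⟩
  rw [h.dep_root, Nat.sub_zero, h.iterate_dep]

theorem isAnc_self (j : ι) : IsAnc par dep j j := ⟨le_rfl, by simp⟩

theorem eq_of_isAnc {j i : ι} (hji : IsAnc par dep j i) (hd : dep j = dep i) : j = i := by
  have := hji.2
  simpa [hd] using this

/-- A proper descendant of `i` is a descendant of exactly one child of `i`. -/
theorem existsUnique_child (h : IsRootedTree r par dep) {j i : ι} (hji : IsAnc par dep j i)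
    (hne : j ≠ i) : ∃! c, (par c = i ∧ c ≠ r) ∧ IsAnc par dep j c := by
  have hlt : dep i < dep j := lt_of_le_of_ne hji.1 fun hd => hne (eq_of_isAnc hji hd.symm)
  have hd := h.dep_iterate j (dep j - dep i - 1)
  refine ⟨par^[dep j - dep i - 1] j, ⟨⟨?_, ?_⟩, ?_, ?_⟩, ?_⟩
  · rw [← Function.iterate_succ_apply' par, Nat.succ_eq_add_one, Nat.sub_add_cancel (by omega)]
    exact hji.2
  · intro h0
    rw [h0, h.dep_root] at hd
    omega
  · omega
  · have h1 : dep j - (dep j - (dep j - dep i - 1)) = dep j - dep i - 1 := by omega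
    rw [hd, h1]
  · rintro c ⟨⟨hc, hcr⟩, hca⟩
    have := h.dep_succ c hcr
    rw [hc] at this
    rw [← hca.2, this, Nat.sub_sub]

theorem isAnc_of_child (h : IsRootedTree r par dep) {j i c : ι} (hc : par c = i) (hcr : c ≠ r)
    (hj : IsAnc par dep j c) : IsAnc par dep j i ∧ j ≠ i := by
  have h1 := h.dep_succ c hcr
  rw [hc] at h1
  have h2 := hj.1
  refine ⟨⟨by omega, ?_⟩, ?_⟩
  · have : dep j - dep i = (dep j - dep c) + 1 := by omega
    rw [this, Function.iterate_succ_apply', hj.2, hc]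
  · rintro rfl
    omega

open Classical in
/-- Summing over subtrees: the subtree at `i` consists of `i` and the subtrees of its children. -/
theorem sum_children [Fintype ι] [DecidableEq ι] {E : Type*} [AddCommGroup E] (h : IsRootedTree r par dep)
    (w : ι → E) (i : ι) :
    ∑ c ∈ Finset.univ.filter (fun c => par c = i ∧ c ≠ r),
        (∑ j, if IsAnc par dep j c then w j else 0)
      = (∑ j, if IsAnc par dep j i then w j else 0) - w i := by
  -- After exchanging the sums, the claim for each `j` is a count: the number of children of `i`
  -- above `j` is one for a proper descendant and zero otherwise.
  have hw : w i = ∑ j, if j = i then w j else 0 := by simp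
  rw [Finset.sum_comm, hw, ← Finset.sum_sub_distrib]
  refine Finset.sum_congr rfl fun j _ => ?_
  by_cases hji : IsAnc par dep j i
  · by_cases hne : j = i
    · subst hne
      rw [if_pos hji, if_pos rfl, sub_self]
      refine Finset.sum_eq_zero fun c hc => if_neg fun hjc => ?_
      rw [Finset.mem_filter] at hc
      exact (h.isAnc_of_child hc.2.1 hc.2.2 hjc).2 rfl
    · obtain ⟨c, ⟨hc1, hc2⟩, hc3⟩ := h.existsUnique_child hji hne
      rw [if_pos hji, if_neg hne, sub_zero, Finset.sum_eq_single c]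
      · rw [if_pos hc2]
      · intro b hb hbc
        refine if_neg fun hjb => hbc (hc3 b ⟨?_, hjb⟩)
        simpa using hb
      · intro hcm
        exact absurd (by simpa using hc1) hcm
  · have hne : j ≠ i := by
      rintro rfl
      exact hji (isAnc_self j)
    rw [if_neg hji, if_neg hne, sub_zero]
    refine Finset.sum_eq_zero fun c hc => if_neg fun hjc => ?_
    rw [Finset.mem_filter] at hc
    exact hji (h.isAnc_of_child hc.2.1 hc.2.2 hjc).1

end IsRootedTree

/-! ### The layered `B`-ary tree -/

/-- The depth of the node `i` in the `B`-ary tree numbered from `0` layer by layer. -/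
def treeDepth (B : ℕ) : ℕ → ℕ
  | 0 => 0
  | i + 1 => treeDepth B (i / B) + 1
decreasing_by exact Nat.lt_succ_of_le (Nat.div_le_self _ _)

/-- The parent map of the `B`-ary tree. -/
def treeParent (B : ℕ) {n : ℕ} (i : Fin n) : Fin n :=
  ⟨((i : ℕ) - 1) / B, lt_of_le_of_lt ((Nat.div_le_self _ _).trans (Nat.sub_le _ _)) i.2⟩

theorem pullEdge_iff {B : ℕ} (hB : 2 ≤ B) {n : ℕ} (j i : Fin n) :
    PullEdge B j i ↔ j = treeParent B i := by
  rw [Fin.ext_iff]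
  simp only [PullEdge, treeParent]
  constructor
  · rintro (⟨h1, h2⟩ | ⟨h1, h2⟩)
    · symm
      rw [Nat.div_eq_iff (by omega)]
      rw [mul_comm] at h1 h2
      omega
    · simp [h1, h2]
  · intro h
    by_cases hi : (i : ℕ) = 0
    · right
      simp [h, hi]
    · left
      have := (Nat.div_eq_iff (by omega : 0 < B)).1 h.symm
      rw [mul_comm] at this
      omega

theorem pullIn_eq {B : ℕ} (hB : 2 ≤ B) {n : ℕ} (i : Fin n) : pullIn B i = {treeParent B i} := by
  ext j
  simp [pullIn, pullEdge_iff hB]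

theorem pushIn_eq {B : ℕ} (hB : 2 ≤ B) {n : ℕ} (i : Fin n) :
    pushIn B i = Finset.univ.filter fun j => treeParent B j = i := by
  ext j
  simp [pushIn, PushEdge, pullEdge_iff hB, eq_comm]

theorem isRootedTree_treeParent (B : ℕ) {n : ℕ} [NeZero n] :
    IsRootedTree (0 : Fin n) (treeParent B) (fun i => treeDepth B i) where
  par_root := by simp [treeParent]
  dep_root := by simp [treeDepth]
  dep_succ := by
    rintro ⟨i, hi⟩ h0
    obtain _ | i := i
    · exact absurd (Fin.ext (by simp)) h0
    · simp [treeDepth, treeParent]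

theorem treeDepth_le {B D i : ℕ} (hB : 2 ≤ B) (h : i < ∑ k ∈ Finset.range (D + 1), B ^ k) :
    treeDepth B i ≤ D := by
  induction D generalizing i with
  | zero =>
    obtain rfl : i = 0 := by simpa using h
    simp [treeDepth]
  | succ D ih =>
    obtain _ | i := i
    · simp [treeDepth]
    · rw [treeDepth]
      refine Nat.succ_le_succ (ih ?_)
      rw [Finset.sum_range_succ'] at h
      simp only [pow_succ', ← Finset.mul_sum, pow_zero] at h
      rw [Nat.div_lt_iff_lt_mul (by omega), mul_comm]
      omega

/-- The logarithm may fall one short of the true depth. Since `d ≥ 1`, the bound `2 * d` absorbs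
this and serves both readings of `d`. -/
theorem treeDepth_le_two_mul {B n d : ℕ} (hB : 2 ≤ B)
    (hd : d = Nat.log B n ∨ IsTreeDepth B n d) (hd1 : 1 ≤ d) (i : Fin n) :
    treeDepth B i ≤ 2 * d := by
  obtain hd | hd := hd
  · have h1 : n < B ^ (d + 1) := hd ▸ Nat.lt_pow_succ_log_self (by omega) n
    have h2 : treeDepth B i ≤ d + 1 := by
      refine treeDepth_le hB ?_
      rw [Finset.sum_range_succ]
      have := i.2
      omega
    omega
  · have := treeDepth_le hB (i.2.trans_le hd.2)
    omega

theorem two_le_of_depth {B n d : ℕ} (hB : 2 ≤ B)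
    (hd : d = Nat.log B n ∨ IsTreeDepth B n d) (hd1 : 1 ≤ d) : 2 ≤ n := by
  obtain hd | hd := hd
  · have : 0 < Nat.log B n := by omega
    have := (Nat.log_pos_iff.1 this).1
    omega
  · have h1 : 1 ≤ ∑ k ∈ Finset.range d, B ^ k := by
      calc 1 = B ^ 0 := by simp
        _ ≤ _ := Finset.single_le_sum (f := fun k => B ^ k) (by intros; positivity)
          (Finset.mem_range.2 hd1)
    have := hd.1
    omega

/-! ### Push-pull recursions on a rooted tree, aligned by arrival time at the root -/

section Aligned

variable {ι : Type*} {E : Type*} [AddCommGroup E] {r : ι} {par : ι → ι} {dep : ι → ℕ}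

/-- The sample `w t j` of node `j` at time `t`, indexed by the time `t + dep j` at which it
reaches the root; `0` before the first arrival. -/
def arrival (dep : ι → ℕ) (w : ℕ → ι → E) (j : ι) (m : ℤ) : E :=
  if m < dep j then 0 else w (m - dep j).toNat j

/-- The state of node `j` at time `m - dep j`, which is the initial one if `m < dep j`. -/
def aligned (dep : ι → ℕ) (x : ℕ → ι → E) (j : ι) (m : ℤ) : E := x (m - dep j).toNat j

theorem arrival_of_lt (w : ℕ → ι → E) {j : ι} {m : ℤ} (h : m < dep j) :
    arrival dep w j m = 0 := if_pos h

theorem arrival_add (w : ℕ → ι → E) (j : ι) (t : ℕ) :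
    arrival dep w j ((t : ℤ) + dep j) = w t j := by
  rw [arrival, if_neg (by omega)]
  congr
  omega

variable [Fintype ι] [Module ℝ E]

/-- The push-pull recursion on a tree with parent map `par`, with samples `g`. -/
structure IsPushPull [DecidableEq ι] (par : ι → ι) (γ : ℝ) (x₀ : E) (g x y : ℕ → ι → E) :
    Prop where
  x_zero : ∀ i, x 0 i = x₀
  x_succ : ∀ t i, x (t + 1) i = x t (par i) - γ • y t (par i)
  y_zero : ∀ i, y 0 i = g 0 i
  y_succ : ∀ t i, y (t + 1) i
    = ∑ j ∈ Finset.univ.filter (fun j => par j = i), y t j + g (t + 1) i - g t i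

variable [DecidableEq ι] {γ : ℝ} {x₀ : E} {g x y : ℕ → ι → E}

-- Children forward their changes one step later and one level higher, so `t + dep` is preserved and
-- the changes of whole subtrees add up; the update at node `i` supplies its own change. At the root
-- the self-loop accumulates the changes, and they telescope to the arrivals themselves.
open Classical in
theorem IsPushPull.y_eq (hp : IsPushPull par γ x₀ g x y) (h : IsRootedTree r par dep) (t : ℕ) :
    y t r = ∑ j, arrival dep g j t ∧ ∀ i, i ≠ r → y t i = ∑ j, if IsAnc par dep j i then
      arrival dep g j ((t : ℤ) + dep i) - arrival dep g j ((t : ℤ) + dep i - 1) else 0 := by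
  induction t with
  | zero =>
    constructor
    · rw [hp.y_zero, Finset.sum_eq_single r]
      · have := arrival_add (dep := dep) g r 0
        rw [h.dep_root] at this
        simpa using this.symm
      · intro j _ hj
        have := h.dep_pos hj
        exact arrival_of_lt g (by omega)
      · simp
    · intro i hi
      rw [hp.y_zero, Finset.sum_eq_single i]
      · rw [if_pos (IsRootedTree.isAnc_self i), arrival_add, arrival_of_lt g (by omega), sub_zero]
      · intro j _ hj
        split_ifs with hji
        · have h1 := hji.1
          have h2 : dep i ≠ dep j := fun hd => hj (IsRootedTree.eq_of_isAnc hji hd.symm)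
          rw [arrival_of_lt g (by omega), arrival_of_lt g (by omega), sub_zero]
        · rfl
      · simp
  | succ t ih =>
    have key : ∀ i, ∑ c ∈ Finset.univ.filter (fun c => par c = i ∧ c ≠ r), y t c
        = (∑ j, if IsAnc par dep j i then arrival dep g j (((t + 1 : ℕ) : ℤ) + dep i)
            - arrival dep g j (((t + 1 : ℕ) : ℤ) + dep i - 1) else 0)
          - (g (t + 1) i - g t i) := by
      intro i
      have h1 := h.sum_children (fun j => arrival dep g j (((t + 1 : ℕ) : ℤ) + dep i)
            - arrival dep g j (((t + 1 : ℕ) : ℤ) + dep i - 1)) i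
      have h2 : arrival dep g i (((t + 1 : ℕ) : ℤ) + dep i - 1) = g t i := by
        rw [← arrival_add (dep := dep) g i t]
        congr 1
        push_cast
        ring
      rw [arrival_add, h2] at h1
      rw [← h1]
      refine Finset.sum_congr rfl fun c hc => ?_
      rw [Finset.mem_filter] at hc
      have h3 := h.dep_succ c hc.2.2
      rw [hc.2.1] at h3
      rw [ih.2 c hc.2.2, h3]
      refine Finset.sum_congr rfl fun j _ => ?_
      have h4 : (t : ℤ) + ((dep i + 1 : ℕ) : ℤ) = ((t + 1 : ℕ) : ℤ) + dep i := by
        push_cast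
        ring
      rw [h4]
    constructor
    · have hf : Finset.univ.filter (fun j => par j = r)
          = insert r (Finset.univ.filter (fun c => par c = r ∧ c ≠ r)) := by
        ext j
        simp only [Finset.mem_filter, Finset.mem_univ, true_and, Finset.mem_insert]
        constructor
        · intro hj
          by_cases hjr : j = r
          · exact Or.inl hjr
          · exact Or.inr ⟨hj, hjr⟩
        · rintro (rfl | hj)
          · exact h.par_root
          · exact hj.1
      rw [hp.y_succ, hf, Finset.sum_insert (by simp), key, ih.1]
      have h5 : ∀ j, IsAnc par dep j r := h.isAnc_root
      simp only [h5, if_true, h.dep_root, Finset.sum_sub_distrib]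
      have h6 : ((t + 1 : ℕ) : ℤ) + ((0 : ℕ) : ℤ) - 1 = t := by
        push_cast
        ring
      rw [h6]
      simp only [Nat.cast_zero, add_zero]
      abel
    · intro i hi
      have hf : Finset.univ.filter (fun j => par j = i)
          = Finset.univ.filter (fun c => par c = i ∧ c ≠ r) := by
        ext j
        simp only [Finset.mem_filter, Finset.mem_univ, true_and]
        refine ⟨fun hj => ⟨hj, ?_⟩, fun hj => hj.1⟩
        rintro rfl
        exact hi (hj.symm.trans h.par_root)
      rw [hp.y_succ, hf, key]
      abel

theorem IsPushPull.aligned_of_le (hp : IsPushPull par γ x₀ g x y) {j : ι} {m : ℤ}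
    (hm : m ≤ dep j) : aligned dep x j m = x₀ := by
  rw [aligned, Int.toNat_of_nonpos (by omega), hp.x_zero]

theorem IsPushPull.aligned_root_add_one (hp : IsPushPull par γ x₀ g x y)
    (h : IsRootedTree r par dep) (a : ℤ) :
    aligned dep x r (a + 1) = aligned dep x r a - γ • ∑ j, arrival dep g j a := by
  by_cases ha : a < 0
  · rw [hp.aligned_of_le (by omega), hp.aligned_of_le (by omega),
      Finset.sum_eq_zero fun j _ => arrival_of_lt g (by omega), smul_zero, sub_zero]
  · lift a to ℕ using by omega
    have h1 : ((a : ℤ) + 1 - (dep r : ℤ)).toNat = a + 1 := by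
      rw [h.dep_root]
      omega
    have h2 : ((a : ℤ) - (dep r : ℤ)).toNat = a := by
      rw [h.dep_root]
      omega
    rw [aligned, aligned, h1, h2, hp.x_succ, h.par_root, (hp.y_eq h a).1]

/-- The root and its children all pull from the root, hence agree at equal times after each update.
On the root clock the child is one unit behind. -/
theorem IsPushPull.aligned_child_of_root (hp : IsPushPull par γ x₀ g x y)
    (h : IsRootedTree r par dep) {l : ι} (hl : l ≠ r) (hlp : par l = r) (a : ℤ) :
    aligned dep x l a = aligned dep x r (a - 1) := by
  have h1 := h.dep_succ l hl
  rw [hlp, h.dep_root] at h1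
  by_cases ha : a ≤ 1
  · rw [hp.aligned_of_le (by omega), hp.aligned_of_le (by omega)]
  · obtain ⟨k, rfl⟩ : ∃ k : ℕ, a = (k : ℤ) + 2 := ⟨(a - 2).toNat, by omega⟩
    have h2 : ((k : ℤ) + 2 - (dep l : ℤ)).toNat = k + 1 := by omega
    have h3 : ((k : ℤ) + 2 - 1 - (dep r : ℤ)).toNat = k + 1 := by
      rw [h.dep_root]
      omega
    rw [aligned, aligned, h2, h3, hp.x_succ, hp.x_succ, hlp, h.par_root]

-- The lag is two: pulling from the parent costs one unit of time, and the clock of the parent is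
-- offset by one unit less of depth.
open Classical in
theorem IsPushPull.aligned_eq (hp : IsPushPull par γ x₀ g x y)
    (h : IsRootedTree r par dep) {l : ι} (hl : l ≠ r) (hlp : par l ≠ r) (a : ℤ) :
    aligned dep x l a = aligned dep x (par l) (a - 2)
      - γ • ∑ j, (if IsAnc par dep j (par l) then
          arrival dep g j (a - 2) - arrival dep g j (a - 3) else 0) := by
  have h1 := h.dep_succ l hl
  by_cases ha : a ≤ dep l
  · rw [hp.aligned_of_le ha, hp.aligned_of_le (by omega), Finset.sum_eq_zero, smul_zero, sub_zero]
    intro j _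
    split_ifs with hj
    · have := hj.1
      rw [arrival_of_lt g (by omega), arrival_of_lt g (by omega), sub_zero]
    · rfl
  · obtain ⟨k, hk⟩ : ∃ k : ℕ, a = (k : ℤ) + 1 + dep l := ⟨(a - dep l - 1).toNat, by omega⟩
    have h2 : (a - (dep l : ℤ)).toNat = k + 1 := by omega
    have h3 : (a - 2 - (dep (par l) : ℤ)).toNat = k := by omega
    rw [aligned, aligned, h2, h3, hp.x_succ, (hp.y_eq h k).2 _ hlp]
    have h4 : (k : ℤ) + dep (par l) = a - 2 := by omega
    have h5 : a - 2 - 1 = a - 3 := by ring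
    rw [h4, h5]

/-- Lagged combination of arrivals describing the displacement of a node from the root. -/
def lagSum (R : ℕ) (α : ℕ → ℝ) (β : ℕ → ι → ℝ) (G : ι → ℤ → E) (a : ℤ) : E :=
  ∑ k ∈ Finset.range R, (α k • ∑ j, G j (a - 1 - k)
    - ∑ j, β k j • (G j (a - 1 - k) - G j (a - 2 - k)))

open Classical in
/-- In arrival time, the displacement of every node from the root is a combination, with
coefficients in `[0, 1]`, of the last total arrivals and the last changes of the individual
arrivals. -/
theorem exists_displacement_coeff (h : IsRootedTree r par dep) (l : ι) :
    ∃ (α : ℕ → ℝ) (β : ℕ → ι → ℝ), (∀ k, 0 ≤ α k ∧ α k ≤ 1) ∧ (∀ k j, 0 ≤ β k j ∧ β k j ≤ 1) ∧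
      ∀ (E : Type*) [AddCommGroup E] [Module ℝ E] (γ : ℝ) (x₀ : E) (g x y : ℕ → ι → E),
        IsPushPull par γ x₀ g x y → ∀ a : ℤ,
        aligned dep x r a - aligned dep x l a
          = -(γ • lagSum (2 * dep l) α β (arrival dep g) a) := by
  induction hk : dep l generalizing l with
  | zero =>
    obtain rfl := h.dep_eq_zero_iff.1 hk
    exact ⟨0, 0, by simp, by simp, by simp [lagSum]⟩
  | succ k ih =>
    have hl : l ≠ r := fun hlr => by
      rw [hlr, h.dep_root] at hk
      omega
    have hd := h.dep_succ l hl
    by_cases hlp : par l = r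
    · rw [hlp, h.dep_root] at hd
      obtain rfl : k = 0 := by omega
      -- A child of the root is behind by exactly one root step, along the total arrivals at time `a
      -- - 1`.
      refine ⟨fun k => if k = 0 then 1 else 0, 0, fun k => by dsimp only; split_ifs <;> norm_num, by simp, ?_⟩
      intro E _ _ γ x₀ g x y hp a
      rw [hp.aligned_child_of_root h hl hlp]
      have := hp.aligned_root_add_one h (a - 1)
      rw [sub_add_cancel] at this
      rw [this]
      simp [lagSum]
    · obtain ⟨α, β, hα, hβ, hrep⟩ := ih (par l) (by omega)
      -- Going down one edge shifts the coefficients of the parent by two lags. The freed lags 0 and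
      -- 1 record the two root steps between `a - 2` and `a`, and lag 1 also records the tracking
      -- variable of the parent, an indicator of its subtree.
      refine ⟨fun k => if k < 2 then 1 else α (k - 2),
        fun k j => if k = 0 then 0 else if k = 1 then (if IsAnc par dep j (par l) then 1 else 0)
          else β (k - 2) j, ?_, ?_, ?_⟩
      · intro k
        dsimp only
        split_ifs
        · norm_num
        · exact hα _
      · intro k j
        dsimp only
        split_ifs
        · norm_num
        · norm_num
        · norm_num
        · exact hβ _ _
      intro E _ _ γ x₀ g x y hp a
      have h1 := hrep E γ x₀ g x y hp (a - 2)
      have h2 := hp.aligned_eq h hl hlp a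
      have h3 := hp.aligned_root_add_one h (a - 1)
      have h4 := hp.aligned_root_add_one h (a - 2)
      rw [sub_add_cancel] at h3
      have h5 : a - 2 + 1 = a - 1 := by ring
      rw [h5] at h4
      have h6 : aligned dep x r a - aligned dep x l a
          = (aligned dep x r (a - 2) - aligned dep x (par l) (a - 2))
            - γ • (∑ j, arrival dep g j (a - 1) + ∑ j, arrival dep g j (a - 2)
              - ∑ j, (if IsAnc par dep j (par l) then
                arrival dep g j (a - 2) - arrival dep g j (a - 3) else 0)) := by
        rw [h2, h3, h4, smul_sub, smul_add]
        abel
      rw [h6, h1, ← neg_add', ← smul_add]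
      congr 2
      have hR : 2 * (k + 1) = 2 * k + 1 + 1 := by ring
      rw [hR, lagSum, lagSum, Finset.sum_range_succ', Finset.sum_range_succ', add_assoc]
      congr 1
      · refine Finset.sum_congr rfl fun i _ => ?_
        have e1 : a - 1 - ((i + 1 + 1 : ℕ) : ℤ) = a - 2 - 1 - i := by
          push_cast
          ring
        push_cast at e1
        have e2 : a - 2 - ((i + 1 + 1 : ℕ) : ℤ) = a - 2 - 2 - i := by
          push_cast
          ring
        push_cast at e2
        simp [e1, e2]
      · have e1 : a - 1 - 1 = a - 2 := by ring
        have e2 : a - 2 - 1 = a - 3 := by ring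
        simp [e1, e2, ite_smul]
        abel

end Aligned

/-! ### Smooth functions -/

section Smooth

variable {p : ℕ} {L : ℝ} {h : EuclideanSpace ℝ (Fin p) → ℝ}

theorem IsSmoothBddBelow.le_quadratic (hh : IsSmoothBddBelow L h)
    (x y : EuclideanSpace ℝ (Fin p)) :
    h y ≤ h x + inner ℝ (gradient h x) (y - x) + L / 2 * ‖y - x‖ ^ 2 := by
  set v := y - x with hv
  have hline : ∀ t : ℝ, HasDerivAt (fun t : ℝ => x + t • v) v t := fun t => by
    simpa using ((hasDerivAt_id t).smul_const v).const_add x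
  have hd : ∀ t : ℝ, HasDerivAt (fun t : ℝ => h (x + t • v) - t * inner ℝ (gradient h x) v
      - L / 2 * ‖v‖ ^ 2 * t ^ 2)
      (inner ℝ (gradient h (x + t • v)) v - inner ℝ (gradient h x) v - L * ‖v‖ ^ 2 * t) t := by
    intro t
    have h1 := (hh.2.1 (x + t • v)).hasGradientAt.hasFDerivAt.comp_hasDerivAt t (hline t)
    have h2 := (hasDerivAt_id t).mul_const (inner ℝ (gradient h x) v)
    have h3 := ((hasDerivAt_id t).pow 2).const_mul (L / 2 * ‖v‖ ^ 2)
    refine ((h1.sub h2).sub h3).congr_deriv ?_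
    simp
    ring
  have hanti : AntitoneOn (fun t : ℝ => h (x + t • v) - t * inner ℝ (gradient h x) v
      - L / 2 * ‖v‖ ^ 2 * t ^ 2) (Set.Icc 0 1) := by
    refine antitoneOn_of_deriv_nonpos (convex_Icc 0 1)
      (fun t _ => (hd t).continuousAt.continuousWithinAt)
      (fun t _ => (hd t).differentiableAt.differentiableWithinAt) fun t ht => ?_
    rw [interior_Icc] at ht
    rw [(hd t).deriv, ← inner_sub_left]
    have h1 := hh.2.2 (x + t • v) x
    rw [add_sub_cancel_left, norm_smul, Real.norm_of_nonneg ht.1.le] at h1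
    have h2 := real_inner_le_norm (gradient h (x + t • v) - gradient h x) v
    have h3 := mul_le_mul_of_nonneg_right h1 (norm_nonneg v)
    nlinarith
  have := hanti (Set.left_mem_Icc.2 zero_le_one) (Set.right_mem_Icc.2 zero_le_one) zero_le_one
  simp only [one_smul, zero_smul, add_zero, hv, add_sub_cancel] at this
  rw [← hv] at this
  linarith

/-- A gradient step of size `1 / L` gains `‖∇h‖² / (2 L)` and cannot fall below the infimum. -/
theorem IsSmoothBddBelow.sq_norm_gradient_le (hL : 0 < L) (hh : IsSmoothBddBelow L h)
    (x : EuclideanSpace ℝ (Fin p)) :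
    ‖gradient h x‖ ^ 2 ≤ 2 * L * (h x - ⨅ y, h y) := by
  have h1 := hh.le_quadratic x (x - (1 / L) • gradient h x)
  have h2 := ciInf_le hh.1 (x - (1 / L) • gradient h x)
  rw [sub_sub_cancel_left, inner_neg_right, norm_neg, inner_smul_right, real_inner_self_eq_norm_sq,
    norm_smul, Real.norm_of_nonneg (by positivity), mul_pow] at h1
  have h3 : L / 2 * ((1 / L) ^ 2 * ‖gradient h x‖ ^ 2) = 1 / L * ‖gradient h x‖ ^ 2 / 2 := by
    field_simp
  rw [h3] at h1
  have h4 : 1 / L * ‖gradient h x‖ ^ 2 ≤ 2 * (h x - ⨅ y, h y) := by linarith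
  calc ‖gradient h x‖ ^ 2 = L * (1 / L * ‖gradient h x‖ ^ 2) := by field_simp
    _ ≤ L * (2 * (h x - ⨅ y, h y)) := by gcongr
    _ = _ := by ring

theorem hasGradientAt_objective {n : ℕ} {f : Fin n → EuclideanSpace ℝ (Fin p) → ℝ}
    (hf : ∀ i, Differentiable ℝ (f i)) (x : EuclideanSpace ℝ (Fin p)) :
    HasGradientAt (objective f) ((1 / (n : ℝ)) • ∑ i, gradient (f i) x) x := by
  rw [hasGradientAt_iff_hasFDerivAt, map_smul, map_sum]
  have h1 : HasFDerivAt (fun x => ∑ i, f i x)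
      (∑ i, (InnerProductSpace.toDual ℝ _) (gradient (f i) x)) x :=
    HasFDerivAt.fun_sum fun i _ => (hf i x).hasGradientAt.hasFDerivAt
  exact h1.const_mul (1 / (n : ℝ))

theorem isSmoothBddBelow_objective {n : ℕ} [NeZero n]
    {f : Fin n → EuclideanSpace ℝ (Fin p) → ℝ} (hf : ∀ i, IsSmoothBddBelow L (f i)) :
    IsSmoothBddBelow L (objective f) := by
  have hn : (0 : ℝ) < n := by exact_mod_cast Nat.pos_of_ne_zero (NeZero.ne n)
  refine ⟨?_, fun x => (hasGradientAt_objective (fun i => (hf i).2.1) x).differentiableAt, ?_⟩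
  · choose c hc using fun i => (hf i).1
    refine ⟨(1 / (n : ℝ)) * ∑ i, c i, ?_⟩
    rintro _ ⟨x, rfl⟩
    rw [objective]
    gcongr with i
    exact hc i ⟨x, rfl⟩
  · intro x y
    rw [(hasGradientAt_objective (fun i => (hf i).2.1) x).gradient,
      (hasGradientAt_objective (fun i => (hf i).2.1) y).gradient, ← smul_sub,
      ← Finset.sum_sub_distrib, norm_smul, Real.norm_of_nonneg (by positivity)]
    calc 1 / (n : ℝ) * ‖∑ i, (gradient (f i) x - gradient (f i) y)‖
        ≤ 1 / (n : ℝ) * ∑ _i : Fin n, L * ‖x - y‖ := by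
          gcongr
          exact (norm_sum_le _ _).trans (Finset.sum_le_sum fun i _ => (hf i).2.2 x y)
      _ = L * ‖x - y‖ := by
          simp
          field_simp

end Smooth

/-! ### Elementary inequalities -/

theorem sq_norm_sum_le {ι E : Type*} [SeminormedAddCommGroup E] (s : Finset ι) (u : ι → E) :
    ‖∑ i ∈ s, u i‖ ^ 2 ≤ s.card * ∑ i ∈ s, ‖u i‖ ^ 2 :=
  (pow_le_pow_left₀ (norm_nonneg _) (norm_sum_le s u) 2).trans sq_sum_le_card_mul_sum_sq

theorem sq_norm_add_le {E : Type*} [SeminormedAddCommGroup E] (u v : E) :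
    ‖u + v‖ ^ 2 ≤ 2 * (‖u‖ ^ 2 + ‖v‖ ^ 2) :=
  (pow_le_pow_left₀ (norm_nonneg _) (norm_add_le u v) 2).trans add_sq_le

theorem sq_norm_sub_le {E : Type*} [SeminormedAddCommGroup E] (u v : E) :
    ‖u - v‖ ^ 2 ≤ 2 * (‖u‖ ^ 2 + ‖v‖ ^ 2) :=
  (pow_le_pow_left₀ (norm_nonneg _) (norm_sub_le u v) 2).trans add_sq_le

theorem sq_norm_sub_sub_le {E : Type*} [SeminormedAddCommGroup E] (u v w : E) :
    ‖u - v - w‖ ^ 2 ≤ 3 * (‖u‖ ^ 2 + ‖v‖ ^ 2 + ‖w‖ ^ 2) := by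
  have h1 := norm_sub_le (u - v) w
  have h2 := norm_sub_le u v
  have h3 : ‖u - v - w‖ ^ 2 ≤ (‖u‖ + ‖v‖ + ‖w‖) ^ 2 :=
    pow_le_pow_left₀ (norm_nonneg _) (by linarith) 2
  nlinarith [sq_nonneg (‖u‖ - ‖v‖), sq_nonneg (‖u‖ - ‖w‖), sq_nonneg (‖v‖ - ‖w‖)]

theorem sum_shift_le {F : ℤ → ℝ} (h0 : ∀ m, 0 ≤ F m) (hneg : ∀ m < 0, F m = 0) (k N : ℕ) :
    ∑ a ∈ Finset.range N, F ((a : ℤ) - k) ≤ ∑ a ∈ Finset.range N, F a := by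
  induction k with
  | zero => simp
  | succ k ih =>
    refine le_trans ?_ ih
    obtain _ | N := N
    · simp
    rw [Finset.sum_range_succ', Finset.sum_range_succ, hneg ((0 : ℕ) - _) (by omega)]
    refine add_le_add (le_of_eq (Finset.sum_congr rfl fun i _ => ?_)) (h0 _)
    congr 1
    push_cast
    ring

theorem sum_range_ite_lt_le {c : ℝ} (hc : 0 ≤ c) (D N : ℕ) :
    ∑ m ∈ Finset.range N, (if m < D then c else 0) ≤ D * c := by
  rw [← Finset.sum_filter, Finset.sum_const, nsmul_eq_mul]
  gcongr
  calc _ ≤ (Finset.range D).card := Finset.card_le_card fun m hm => by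
        simpa using (Finset.mem_filter.1 hm).2
    _ = D := Finset.card_range D

/-! ### Norm bounds for lagged sums. -/

section LagSum

variable {ι : Type*} [Fintype ι] {E : Type*} [NormedAddCommGroup E] [NormedSpace ℝ E]

theorem lagSum_add (R : ℕ) (α : ℕ → ℝ) (β : ℕ → ι → ℝ) (G H : ι → ℤ → E) (a : ℤ) :
    lagSum R α β (fun j m => G j m + H j m) a = lagSum R α β G a + lagSum R α β H a := by
  simp only [lagSum, ← Finset.sum_add_distrib]
  refine Finset.sum_congr rfl fun k _ => ?_
  have : ∀ j, β k j • (G j (a - 1 - k) + H j (a - 1 - k) - (G j (a - 2 - k) + H j (a - 2 - k)))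
      = β k j • (G j (a - 1 - k) - G j (a - 2 - k))
        + β k j • (H j (a - 1 - k) - H j (a - 2 - k)) := fun j => by
    rw [← smul_add]
    congr 1
    abel
  simp only [this, Finset.sum_add_distrib, smul_add]
  abel

theorem norm_smul_le_of_mem {c : ℝ} (hc : 0 ≤ c ∧ c ≤ 1) (u : E) : ‖c • u‖ ≤ ‖u‖ := by
  rw [norm_smul, Real.norm_of_nonneg hc.1]
  exact mul_le_of_le_one_left (norm_nonneg u) hc.2

theorem sq_norm_lagSum_le {R : ℕ} {α : ℕ → ℝ} {β : ℕ → ι → ℝ} (hα : ∀ k, 0 ≤ α k ∧ α k ≤ 1)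
    (hβ : ∀ k j, 0 ≤ β k j ∧ β k j ≤ 1) (G : ι → ℤ → E) (a : ℤ) :
    ‖lagSum R α β G a‖ ^ 2 ≤ 2 * R * ∑ k ∈ Finset.range R, (‖∑ j, G j (a - 1 - k)‖ ^ 2
      + Fintype.card ι * ∑ j, ‖G j (a - 1 - k) - G j (a - 2 - k)‖ ^ 2) := by
  refine (sq_norm_sum_le _ _).trans ?_
  rw [Finset.card_range, mul_comm 2 (R : ℝ), mul_assoc]
  refine mul_le_mul_of_nonneg_left ?_ (Nat.cast_nonneg R)
  rw [Finset.mul_sum]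
  refine Finset.sum_le_sum fun k _ => (sq_norm_sub_le _ _).trans ?_
  gcongr
  · exact norm_smul_le_of_mem (hα k) _
  · refine (sq_norm_sum_le _ _).trans ?_
    rw [Finset.card_univ]
    gcongr with j
    exact norm_smul_le_of_mem (hβ k j) _

/-- One factor `R` comes from Cauchy-Schwarz over the lags. The other counts the shifted copies of
the same sum, none larger than the unshifted one because everything vanishes at negative times. -/
theorem sum_sq_norm_lagSum_le {R R' : ℕ} (hR : R ≤ R') {α : ℕ → ℝ} {β : ℕ → ι → ℝ}
    (hα : ∀ k, 0 ≤ α k ∧ α k ≤ 1) (hβ : ∀ k j, 0 ≤ β k j ∧ β k j ≤ 1) {G : ι → ℤ → E}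
    (hG : ∀ j, ∀ m < 0, G j m = 0) (N : ℕ) :
    ∑ a ∈ Finset.range N, ‖lagSum R α β G a‖ ^ 2
      ≤ 2 * (R' : ℝ) ^ 2 * (∑ a ∈ Finset.range N, ‖∑ j, G j a‖ ^ 2
        + Fintype.card ι * ∑ a ∈ Finset.range N, ∑ j, ‖G j a - G j (a - 1)‖ ^ 2) := by
  set F : ℤ → ℝ := fun m => ‖∑ j, G j m‖ ^ 2
      + Fintype.card ι * ∑ j, ‖G j m - G j (m - 1)‖ ^ 2 with hF
  have hF0 : ∀ m, 0 ≤ F m := fun m => by positivity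
  have hFneg : ∀ m < 0, F m = 0 := fun m hm => by
    simp [hF, hG _ m hm, hG _ (m - 1) (by omega)]
  have hsum : ∑ a ∈ Finset.range N, ‖∑ j, G j a‖ ^ 2
        + Fintype.card ι * ∑ a ∈ Finset.range N, ∑ j, ‖G j a - G j (a - 1)‖ ^ 2
      = ∑ a ∈ Finset.range N, F a := by
    rw [Finset.mul_sum, ← Finset.sum_add_distrib]
  rw [hsum]
  calc ∑ a ∈ Finset.range N, ‖lagSum R α β G a‖ ^ 2
      ≤ ∑ a ∈ Finset.range N, 2 * R * ∑ k ∈ Finset.range R, F ((a : ℤ) - (k + 1 : ℕ)) := by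
        refine Finset.sum_le_sum fun a _ => (sq_norm_lagSum_le hα hβ G a).trans (le_of_eq ?_)
        congr 1
        refine Finset.sum_congr rfl fun k _ => ?_
        have e1 : (a : ℤ) - 1 - k = a - (k + 1 : ℕ) := by
          push_cast
          ring
        have e2 : (a : ℤ) - 2 - k = a - (k + 1 : ℕ) - 1 := by
          push_cast
          ring
        rw [hF, e1, e2]
    _ = 2 * R * ∑ k ∈ Finset.range R, ∑ a ∈ Finset.range N, F ((a : ℤ) - (k + 1 : ℕ)) := by
        rw [← Finset.mul_sum, Finset.sum_comm]
    _ ≤ 2 * R * ∑ _k ∈ Finset.range R, ∑ a ∈ Finset.range N, F a := by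
        refine mul_le_mul_of_nonneg_left (Finset.sum_le_sum fun k _ => ?_) (by positivity)
        exact sum_shift_le hF0 hFneg _ _
    _ = 2 * (R : ℝ) ^ 2 * ∑ a ∈ Finset.range N, F a := by
        rw [Finset.sum_const, Finset.card_range, nsmul_eq_mul]
        ring
    _ ≤ 2 * (R' : ℝ) ^ 2 * ∑ a ∈ Finset.range N, F a := by
        have : 0 ≤ ∑ a ∈ Finset.range N, F a := Finset.sum_nonneg fun a _ => hF0 a
        gcongr

end LagSum

/-! ### Delayed gradient descent along one sample path -/

section Path

variable {ι : Type*} [Fintype ι] {E : Type*} [NormedAddCommGroup E] [InnerProductSpace ℝ E]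

/-- The gradients that reach the root at time `m`, evaluated at the aligned states. -/
def delayed (dep : ι → ℕ) (h : ι → E → E) (p : ι → ℤ → E) (j : ι) (m : ℤ) : E :=
  if m < dep j then 0 else h j (p j m)

/-- Aligned states `p` driven by delayed gradients with noise `ζ`: the root takes a step along
the sum of all arrivals, and the displacements of the nodes are lagged combinations of arrivals. -/
structure IsDelayedDescent (L γ : ℝ) (r : ι) (dep : ι → ℕ) (D : ℕ) (h : ι → E → E) (x₀ : E)
    (α : ι → ℕ → ℝ) (β : ι → ℕ → ι → ℝ) (p ζ : ι → ℤ → E) : Prop where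
  lipschitz : ∀ j x y, ‖h j x - h j y‖ ≤ L * ‖x - y‖
  dep_le : ∀ j, dep j ≤ D
  init : ∀ j (m : ℤ), m ≤ dep j → p j m = x₀
  noise_of_lt : ∀ j (m : ℤ), m < dep j → ζ j m = 0
  step : ∀ a : ℤ, p r (a + 1) = p r a - γ • ∑ j, (delayed dep h p j a + ζ j a)
  coeff : ∀ l k, 0 ≤ α l k ∧ α l k ≤ 1
  coeff' : ∀ l k j, 0 ≤ β l k j ∧ β l k j ≤ 1
  displacement : ∀ l (a : ℤ), p r a - p l a = -(γ • lagSum (2 * dep l) (α l) (β l)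
    (fun j m => delayed dep h p j m + ζ j m) a)

namespace IsDelayedDescent

variable {L γ : ℝ} {r : ι} {dep : ι → ℕ} {D : ℕ} {h : ι → E → E} {x₀ : E}
  {α : ι → ℕ → ℝ} {β : ι → ℕ → ι → ℝ} {p ζ : ι → ℤ → E}

theorem init_of_neg (H : IsDelayedDescent L γ r dep D h x₀ α β p ζ) (j : ι) {m : ℤ}
    (hm : m ≤ 0) : p j m = x₀ := H.init j m (by omega)

theorem step_eq (H : IsDelayedDescent L γ r dep D h x₀ α β p ζ) (a : ℤ) :
    p r (a + 1) - p r a = -(γ • (∑ j, delayed dep h p j a + ∑ j, ζ j a)) := by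
  rw [H.step, Finset.sum_add_distrib]
  abel

theorem sq_norm_step_le (H : IsDelayedDescent L γ r dep D h x₀ α β p ζ) (a : ℤ) :
    ‖p r (a + 1) - p r a‖ ^ 2
      ≤ 2 * γ ^ 2 * (‖∑ j, delayed dep h p j a‖ ^ 2 + ‖∑ j, ζ j a‖ ^ 2) := by
  rw [H.step_eq, norm_neg, norm_smul, mul_pow, Real.norm_eq_abs, sq_abs, mul_comm 2, mul_assoc]
  exact mul_le_mul_of_nonneg_left (sq_norm_add_le _ _) (sq_nonneg γ)

/-- The gradients at `x₀` that have not reached the root by time `m`. -/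
def missing (dep : ι → ℕ) (h : ι → E → E) (x₀ : E) (m : ℤ) : E :=
  ∑ j, if m < dep j then h j x₀ else 0

theorem sq_norm_missing_le (H : IsDelayedDescent L γ r dep D h x₀ α β p ζ) (m : ℕ) :
    ‖missing dep h x₀ m‖ ^ 2
      ≤ if m < D then Fintype.card ι * ∑ j, ‖h j x₀‖ ^ 2 else 0 := by
  split_ifs with hm
  · refine (sq_norm_sum_le _ _).trans ?_
    rw [Finset.card_univ]
    gcongr with j
    split_ifs
    · exact le_rfl
    · simp
  · rw [missing, Finset.sum_eq_zero]
    · simp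
    · intro j _
      have := H.dep_le j
      exact if_neg (by omega)

/-- Before its first arrival the aligned state of a node is still `x₀`, so the absent term is
exactly `h j x₀`. -/
theorem sum_delayed_eq (H : IsDelayedDescent L γ r dep D h x₀ α β p ζ) (m : ℤ) :
    ∑ j, delayed dep h p j m
      = ∑ j, h j (p r m) - ∑ j, (h j (p r m) - h j (p j m)) - missing dep h x₀ m := by
  rw [missing, ← Finset.sum_sub_distrib, ← Finset.sum_sub_distrib]
  refine Finset.sum_congr rfl fun j _ => ?_
  rw [delayed]
  split_ifs with hj
  · rw [H.init j m hj.le]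
    abel
  · abel

theorem sq_norm_deviation_le (H : IsDelayedDescent L γ r dep D h x₀ α β p ζ) (m : ℤ) :
    ‖∑ j, (h j (p r m) - h j (p j m))‖ ^ 2
      ≤ Fintype.card ι * (L ^ 2 * ∑ j, ‖p r m - p j m‖ ^ 2) := by
  refine (sq_norm_sum_le _ _).trans ?_
  rw [Finset.card_univ, Finset.mul_sum _ _ (L ^ 2)]
  refine mul_le_mul_of_nonneg_left (Finset.sum_le_sum fun j _ => ?_) (Nat.cast_nonneg _)
  rw [← mul_pow]
  exact pow_le_pow_left₀ (norm_nonneg _) (H.lipschitz j _ _) 2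

theorem sum_sq_norm_delayed_le (H : IsDelayedDescent L γ r dep D h x₀ α β p ζ)
    {F : E → E} (hF : ∀ x, ∑ j, h j x = (Fintype.card ι : ℝ) • F x) (N : ℕ) :
    ∑ m ∈ Finset.range N, ‖∑ j, delayed dep h p j m‖ ^ 2
      ≤ 3 * ((Fintype.card ι : ℝ) ^ 2 * ∑ m ∈ Finset.range N, ‖F (p r m)‖ ^ 2
        + Fintype.card ι * (L ^ 2 * ∑ m ∈ Finset.range N, ∑ j, ‖p r m - p j m‖ ^ 2)
        + D * (Fintype.card ι * ∑ j, ‖h j x₀‖ ^ 2)) := by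
  have h1 : ∀ m : ℕ, ‖∑ j, delayed dep h p j m‖ ^ 2
      ≤ 3 * ((Fintype.card ι : ℝ) ^ 2 * ‖F (p r m)‖ ^ 2
        + Fintype.card ι * (L ^ 2 * ∑ j, ‖p r m - p j m‖ ^ 2)
        + if m < D then Fintype.card ι * ∑ j, ‖h j x₀‖ ^ 2 else 0) := by
    intro m
    rw [H.sum_delayed_eq]
    refine (sq_norm_sub_sub_le _ _ _).trans ?_
    have e : ‖∑ j, h j (p r m)‖ ^ 2 = (Fintype.card ι : ℝ) ^ 2 * ‖F (p r m)‖ ^ 2 := by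
      rw [hF, norm_smul, mul_pow, Real.norm_natCast]
    rw [e]
    gcongr
    · exact H.sq_norm_deviation_le m
    · exact H.sq_norm_missing_le m
  refine (Finset.sum_le_sum fun m _ => h1 m).trans ?_
  rw [← Finset.mul_sum, Finset.sum_add_distrib, Finset.sum_add_distrib, ← Finset.mul_sum,
    ← Finset.mul_sum, ← Finset.mul_sum]
  gcongr
  exact sum_range_ite_lt_le (by positivity) _ _

/-- Apart from Lipschitz changes there is a single jump, from `0` to `h j x₀`, at the first arrival.
-/
theorem sq_norm_delayed_sub_le (H : IsDelayedDescent L γ r dep D h x₀ α β p ζ)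
    (j : ι) (m : ℤ) :
    ‖delayed dep h p j m - delayed dep h p j (m - 1)‖ ^ 2
      ≤ L ^ 2 * ‖p j m - p j (m - 1)‖ ^ 2 + if m = dep j then ‖h j x₀‖ ^ 2 else 0 := by
  rw [delayed, delayed]
  rcases lt_trichotomy m (dep j) with hm | hm | hm
  · rw [if_pos hm, if_pos (by omega), if_neg hm.ne]
    simp only [sub_zero, norm_zero, add_zero, zero_pow two_ne_zero]
    positivity
  · rw [if_neg (by omega), if_pos (by omega), if_pos hm, H.init j m hm.le, sub_zero]
    have : 0 ≤ L ^ 2 * ‖x₀ - p j (m - 1)‖ ^ 2 := by positivity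
    linarith
  · rw [if_neg (by omega), if_neg (by omega), if_neg (by omega), add_zero, ← mul_pow]
    exact pow_le_pow_left₀ (norm_nonneg _) (H.lipschitz j _ _) 2

theorem sum_sq_norm_delayed_sub_le (H : IsDelayedDescent L γ r dep D h x₀ α β p ζ) (N : ℕ) :
    ∑ m ∈ Finset.range N, ∑ j, ‖delayed dep h p j m - delayed dep h p j (m - 1)‖ ^ 2
      ≤ ∑ j, ‖h j x₀‖ ^ 2 + 3 * L ^ 2 * (Fintype.card ι * (2 * γ ^ 2 *
          (∑ m ∈ Finset.range N, ‖∑ j, delayed dep h p j m‖ ^ 2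
            + ∑ m ∈ Finset.range N, ‖∑ j, ζ j m‖ ^ 2))
        + 2 * ∑ m ∈ Finset.range N, ∑ j, ‖p r m - p j m‖ ^ 2) := by
  set A : ℤ → ℝ := fun m => 2 * γ ^ 2 * (‖∑ j, delayed dep h p j m‖ ^ 2 + ‖∑ j, ζ j m‖ ^ 2)
    with hA
  set S : ℤ → ℝ := fun m => ∑ j, ‖p r m - p j m‖ ^ 2 with hS
  have h1 : ∀ m : ℤ, ∑ j, ‖p j m - p j (m - 1)‖ ^ 2
      ≤ 3 * (Fintype.card ι * A (m - 1) + S m + S (m - 1)) := by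
    intro m
    have hj : ∀ j, ‖p j m - p j (m - 1)‖ ^ 2
        ≤ 3 * (A (m - 1) + ‖p r m - p j m‖ ^ 2 + ‖p r (m - 1) - p j (m - 1)‖ ^ 2) := by
      intro j
      -- The move of a node is the move of the root corrected by its displacements at both ends.
      have e : p j m - p j (m - 1)
          = (p r m - p r (m - 1)) - (p r m - p j m) - (p j (m - 1) - p r (m - 1)) := by abel
      have hs := H.sq_norm_step_le (m - 1)
      rw [sub_add_cancel] at hs
      rw [e]
      refine (sq_norm_sub_sub_le _ _ _).trans ?_
      rw [norm_sub_rev (p j (m - 1))]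
      gcongr
    refine (Finset.sum_le_sum fun j _ => hj j).trans (le_of_eq ?_)
    rw [← Finset.mul_sum, Finset.sum_add_distrib, Finset.sum_add_distrib, Finset.sum_const,
      Finset.card_univ, nsmul_eq_mul]
  have hA0 : ∀ m, 0 ≤ A m := fun m => by positivity
  have hS0 : ∀ m, 0 ≤ S m := fun m => by positivity
  have hAneg : ∀ m < 0, A m = 0 := fun m hm => by
    have e1 : ∀ j, delayed dep h p j m = 0 := fun j => if_pos (by omega)
    have e2 : ∀ j, ζ j m = 0 := fun j => H.noise_of_lt j m (by omega)
    simp [hA, e1, e2]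
  have hSneg : ∀ m < 0, S m = 0 := fun m hm => by
    simp [hS, H.init_of_neg _ hm.le]
  have h2 := sum_shift_le hA0 hAneg 1 N
  have h3 := sum_shift_le hS0 hSneg 1 N
  simp only [Nat.cast_one] at h2 h3
  have h4 : ∑ m ∈ Finset.range N, ∑ j, (if (m : ℤ) = dep j then ‖h j x₀‖ ^ 2 else 0)
      ≤ ∑ j, ‖h j x₀‖ ^ 2 := by
    rw [Finset.sum_comm]
    refine Finset.sum_le_sum fun j _ => ?_
    simp only [Nat.cast_inj]
    rw [Finset.sum_ite_eq']
    split_ifs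
    · exact le_rfl
    · positivity
  have h5 : ∑ m ∈ Finset.range N, A m = 2 * γ ^ 2 *
      (∑ m ∈ Finset.range N, ‖∑ j, delayed dep h p j m‖ ^ 2
        + ∑ m ∈ Finset.range N, ‖∑ j, ζ j m‖ ^ 2) := by
    rw [← Finset.sum_add_distrib, Finset.mul_sum]
  rw [← h5]
  calc _ ≤ ∑ m ∈ Finset.range N, (L ^ 2 * (3 * (Fintype.card ι * A (m - 1) + S m + S (m - 1)))
        + ∑ j, (if (m : ℤ) = dep j then ‖h j x₀‖ ^ 2 else 0)) := by
        refine Finset.sum_le_sum fun m _ =>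
          (Finset.sum_le_sum fun j _ => H.sq_norm_delayed_sub_le j m).trans ?_
        rw [Finset.sum_add_distrib, ← Finset.mul_sum]
        gcongr
        exact h1 m
    _ = 3 * L ^ 2 * (Fintype.card ι * ∑ m ∈ Finset.range N, A (m - 1)
          + ∑ m ∈ Finset.range N, S m + ∑ m ∈ Finset.range N, S (m - 1))
        + ∑ m ∈ Finset.range N, ∑ j, (if (m : ℤ) = dep j then ‖h j x₀‖ ^ 2 else 0) := by
        rw [Finset.sum_add_distrib, ← Finset.mul_sum, ← Finset.mul_sum, Finset.sum_add_distrib,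
          Finset.sum_add_distrib, ← Finset.mul_sum]
        ring
    _ ≤ 3 * L ^ 2 * (Fintype.card ι * ∑ m ∈ Finset.range N, A m
          + ∑ m ∈ Finset.range N, S m + ∑ m ∈ Finset.range N, S m)
        + ∑ j, ‖h j x₀‖ ^ 2 := by gcongr
    _ = _ := by ring

/-- Noise and gradients are separated here because only the gradient part is bounded pathwise. The
noise part is kept intact so that orthogonality can later save a factor of the window length. -/
theorem sum_sq_norm_displacement_le (H : IsDelayedDescent L γ r dep D h x₀ α β p ζ) (N : ℕ) :
    ∑ m ∈ Finset.range N, ∑ l, ‖p r m - p l m‖ ^ 2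
      ≤ 2 * γ ^ 2 * (∑ m ∈ Finset.range N, ∑ l, ‖lagSum (2 * dep l) (α l) (β l) ζ m‖ ^ 2
        + Fintype.card ι * (8 * (D : ℝ) ^ 2 *
          (∑ m ∈ Finset.range N, ‖∑ j, delayed dep h p j m‖ ^ 2
            + Fintype.card ι * ∑ m ∈ Finset.range N,
              ∑ j, ‖delayed dep h p j m - delayed dep h p j (m - 1)‖ ^ 2))) := by
  have h1 : ∀ m : ℕ, ∀ l, ‖p r m - p l m‖ ^ 2
      ≤ 2 * γ ^ 2 * (‖lagSum (2 * dep l) (α l) (β l) ζ m‖ ^ 2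
        + ‖lagSum (2 * dep l) (α l) (β l) (delayed dep h p) m‖ ^ 2) := by
    intro m l
    rw [H.displacement, norm_neg, norm_smul, mul_pow, Real.norm_eq_abs, sq_abs, lagSum_add,
      add_comm (lagSum _ _ _ (fun j m => delayed dep h p j m) _)]
    refine (mul_le_mul_of_nonneg_left (sq_norm_add_le _ _) (sq_nonneg γ)).trans (le_of_eq ?_)
    ring
  have h2 : ∀ l, ∑ m ∈ Finset.range N, ‖lagSum (2 * dep l) (α l) (β l) (delayed dep h p) m‖ ^ 2
      ≤ 8 * (D : ℝ) ^ 2 *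
          (∑ m ∈ Finset.range N, ‖∑ j, delayed dep h p j m‖ ^ 2
            + Fintype.card ι * ∑ m ∈ Finset.range N,
              ∑ j, ‖delayed dep h p j m - delayed dep h p j (m - 1)‖ ^ 2) := by
    intro l
    have := sum_sq_norm_lagSum_le (E := E) (R := 2 * dep l) (R' := 2 * D) (by have := H.dep_le l; omega)
      (H.coeff l) (H.coeff' l) (G := delayed dep h p) (fun j m hm => if_pos (by omega)) N
    refine this.trans (le_of_eq ?_)
    push_cast
    ring
  refine (Finset.sum_le_sum fun m _ => Finset.sum_le_sum fun l _ => h1 m l).trans ?_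
  simp only [← Finset.mul_sum, Finset.sum_add_distrib]
  gcongr
  rw [Finset.sum_comm]
  refine (Finset.sum_le_sum fun l _ => h2 l).trans (le_of_eq ?_)
  rw [Finset.sum_const, Finset.card_univ, nsmul_eq_mul]

/-- Gradients are missing only while `m < D`, and during that time the root has made fewer than `D`
steps. Hence `F` at the root is compared with `F x₀`, which the initial gap controls. -/
theorem sum_inner_missing_le (H : IsDelayedDescent L γ r dep D h x₀ α β p ζ) [Nonempty ι]
    {F : E → E} (hLF : ∀ x y, ‖F x - F y‖ ≤ L * ‖x - y‖) (hD : 1 ≤ D) (N : ℕ) :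
    ∑ m ∈ Finset.range N, inner ℝ (F (p r m)) (missing dep h x₀ m)
      ≤ 1 / 5 * ∑ j, ‖h j x₀‖ ^ 2 + 5 / 2 * (D : ℝ) ^ 2 * Fintype.card ι * (‖F x₀‖ ^ 2
        + 2 * L ^ 2 * γ ^ 2 * D * (∑ m ∈ Finset.range N, ‖∑ j, delayed dep h p j m‖ ^ 2
            + ∑ m ∈ Finset.range N, ‖∑ j, ζ j m‖ ^ 2)) := by
  set Φ := ∑ j, ‖h j x₀‖ ^ 2
  set Z := ∑ m ∈ Finset.range N, ‖∑ j, delayed dep h p j m‖ ^ 2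
            + ∑ m ∈ Finset.range N, ‖∑ j, ζ j m‖ ^ 2 with hZ
  have hn : (0 : ℝ) < Fintype.card ι := by exact_mod_cast Fintype.card_pos
  have hD0 : (0 : ℝ) < D := by exact_mod_cast hD
  have hdist : ∀ m : ℕ, m ≤ N → m < D → ‖p r m - x₀‖ ^ 2 ≤ 2 * γ ^ 2 * D * Z := by
    intro m hmN hmD
    have e : p r m - x₀ = ∑ s ∈ Finset.range m, (p r (s + 1) - p r s) := by
      have := Finset.sum_range_sub (fun s : ℕ => p r s) m
      push_cast at this
      rw [this, H.init_of_neg r le_rfl]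
    rw [e]
    refine (sq_norm_sum_le _ _).trans ?_
    rw [Finset.card_range]
    calc (m : ℝ) * ∑ s ∈ Finset.range m, ‖p r (s + 1) - p r s‖ ^ 2
        ≤ (D : ℝ) * ∑ s ∈ Finset.range N, ‖p r (s + 1) - p r s‖ ^ 2 := by
          gcongr
      _ ≤ (D : ℝ) * ∑ s ∈ Finset.range N,
            2 * γ ^ 2 * (‖∑ j, delayed dep h p j s‖ ^ 2 + ‖∑ j, ζ j s‖ ^ 2) := by
          gcongr with s
          exact H.sq_norm_step_le s
      _ = _ := by
          rw [← Finset.mul_sum, Finset.sum_add_distrib]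
          ring
  have hterm : ∀ m ∈ Finset.range N, inner ℝ (F (p r m)) (missing dep h x₀ m)
      ≤ if m < D then 1 / (5 * D) * Φ + 5 / 2 * D * Fintype.card ι *
        (‖F x₀‖ ^ 2 + 2 * L ^ 2 * γ ^ 2 * D * Z) else 0 := by
    intro m hm
    have hU := H.sq_norm_missing_le m
    split_ifs at hU ⊢ with hmD
    · have h1 := hdist m (Finset.mem_range.1 hm).le hmD
      have h2 : ‖F (p r m)‖ ^ 2 ≤ 2 * (‖F x₀‖ ^ 2 + 2 * L ^ 2 * γ ^ 2 * D * Z) := by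
        have e : F (p r m) = F x₀ + (F (p r m) - F x₀) := by abel
        rw [e]
        refine (sq_norm_add_le _ _).trans ?_
        gcongr
        calc ‖F (p r m) - F x₀‖ ^ 2 ≤ (L * ‖p r m - x₀‖) ^ 2 :=
              pow_le_pow_left₀ (norm_nonneg _) (hLF _ _) 2
          _ = L ^ 2 * ‖p r m - x₀‖ ^ 2 := by ring
          _ ≤ L ^ 2 * (2 * γ ^ 2 * D * Z) := by gcongr
          _ = _ := by ring
      have h3 := real_inner_le_norm (F (p r m)) (missing dep h x₀ m)
      set u := ‖F (p r m)‖
      set w := ‖missing dep h x₀ m‖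
      set C := ‖F x₀‖ ^ 2 + 2 * L ^ 2 * γ ^ 2 * D * Z
      set n : ℝ := (Fintype.card ι : ℝ)
      -- Young's inequality with weight `1 / (5 D n)`: as `w ^ 2 ≤ n Φ`, the at most `D` affected
      -- steps cost `Φ / 5` in total, well below the `Φ / 2` allowed at the end.
      have h4 : u * w ≤ 1 / (5 * (D * n)) * w ^ 2 + 5 / 4 * (D * n) * u ^ 2 := by
        have hDn : 0 < (D : ℝ) * n := by positivity
        have e : 1 / (5 * (D * n)) * w ^ 2 + 5 / 4 * (D * n) * u ^ 2 - u * w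
            = 1 / (5 * (D * n)) * (w - 5 / 2 * (D * n) * u) ^ 2 := by
          field_simp
          ring
        have : 0 ≤ 1 / (5 * (D * n)) * (w - 5 / 2 * (D * n) * u) ^ 2 := by positivity
        linarith
      calc _ ≤ u * w := h3
        _ ≤ 1 / (5 * (D * n)) * w ^ 2 + 5 / 4 * (D * n) * u ^ 2 := h4
        _ ≤ 1 / (5 * (D * n)) * (n * Φ) + 5 / 4 * (D * n) * (2 * C) := by gcongr
        _ = _ := by
          field_simp
          ring
    · have h0 : missing dep h x₀ m = 0 := by
        have : ‖missing dep h x₀ m‖ ^ 2 = 0 := le_antisymm hU (sq_nonneg _)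
        simpa using this
      rw [h0, inner_zero_right]
  have hZ0 : 0 ≤ Z := by positivity
  have hΦ0 : 0 ≤ Φ := by positivity
  refine (Finset.sum_le_sum hterm).trans ((sum_range_ite_lt_le (by positivity) _ _).trans
    (le_of_eq ?_))
  field_simp

/-- The descent inequality at each root step, telescoped, with the step split into the true
gradient, the deviation due to displacements, the missing gradients and the noise. -/
theorem descent (H : IsDelayedDescent L γ r dep D h x₀ α β p ζ) [Nonempty ι]
    (hL : 0 < L) (hγ : 0 ≤ γ) {F : E → E}
    (hF : ∀ x, ∑ j, h j x = (Fintype.card ι : ℝ) • F x) {φ : E → ℝ} {φ₀ : ℝ}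
    (hφ : ∀ x y, φ y ≤ φ x + inner ℝ (F x) (y - x) + L / 2 * ‖y - x‖ ^ 2)
    (hφ₀ : ∀ x, φ₀ ≤ φ x) (N : ℕ) :
    3 / 4 * (γ * Fintype.card ι) * ∑ m ∈ Finset.range N, ‖F (p r m)‖ ^ 2
      ≤ φ x₀ - φ₀ + γ * (L ^ 2 * ∑ m ∈ Finset.range N, ∑ j, ‖p r m - p j m‖ ^ 2)
        - γ * ∑ m ∈ Finset.range N, inner ℝ (F (p r m)) (∑ j, ζ j m)
        + γ * ∑ m ∈ Finset.range N, inner ℝ (F (p r m)) (missing dep h x₀ m)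
        + L * γ ^ 2 * (∑ m ∈ Finset.range N, ‖∑ j, delayed dep h p j m‖ ^ 2
            + ∑ m ∈ Finset.range N, ‖∑ j, ζ j m‖ ^ 2) := by
  set n : ℝ := (Fintype.card ι : ℝ) with hn
  have hn0 : (0 : ℝ) < n := by rw [hn]; exact_mod_cast Fintype.card_pos
  have hstep : ∀ m : ℕ, 3 / 4 * (γ * n) * ‖F (p r m)‖ ^ 2
      ≤ (φ (p r m) - φ (p r (m + 1))) + γ * (L ^ 2 * ∑ j, ‖p r m - p j m‖ ^ 2)
        - γ * inner ℝ (F (p r m)) (∑ j, ζ j m)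
        + γ * inner ℝ (F (p r m)) (missing dep h x₀ m)
        + L * γ ^ 2 * (‖∑ j, delayed dep h p j m‖ ^ 2 + ‖∑ j, ζ j m‖ ^ 2) := by
    intro m
    have h1 := hφ (p r m) (p r (m + 1))
    have h2 := H.sq_norm_step_le m
    have h3 : inner ℝ (F (p r m)) (p r (m + 1) - p r m)
        = -γ * (n * ‖F (p r m)‖ ^ 2)
          + γ * inner ℝ (F (p r m)) (∑ j, (h j (p r m) - h j (p j m)))
          + γ * inner ℝ (F (p r m)) (missing dep h x₀ m)
          - γ * inner ℝ (F (p r m)) (∑ j, ζ j m) := by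
      rw [H.step_eq, inner_neg_right, inner_smul_right, inner_add_right, H.sum_delayed_eq, hF,
        inner_sub_right, inner_sub_right, inner_smul_right, real_inner_self_eq_norm_sq]
      ring
    have h4 := real_inner_le_norm (F (p r m)) (∑ j, (h j (p r m) - h j (p j m)))
    have h5 := H.sq_norm_deviation_le m
    set q := ‖∑ j, (h j (p r m) - h j (p j m))‖
    set u := ‖F (p r m)‖
    set S := L ^ 2 * ∑ j, ‖p r m - p j m‖ ^ 2
    -- The deviation takes a quarter of `n ‖F‖²`, which leaves the factor `3 / 4`.
    have h6 : u * q ≤ n / 4 * u ^ 2 + S := by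
      have e : n / 4 * u ^ 2 + 1 / n * q ^ 2 - u * q = 1 / n * (n / 2 * u - q) ^ 2 := by
        field_simp
        ring
      have e0 : 0 ≤ 1 / n * (n / 2 * u - q) ^ 2 := by positivity
      have e1 : 1 / n * q ^ 2 ≤ 1 / n * (n * S) := by gcongr
      have e2 : 1 / n * (n * S) = S := by field_simp
      linarith
    have h7 := mul_le_mul_of_nonneg_left (h4.trans h6) hγ
    have h8 : L / 2 * ‖p r (m + 1) - p r m‖ ^ 2
        ≤ L / 2 * (2 * γ ^ 2 * (‖∑ j, delayed dep h p j m‖ ^ 2 + ‖∑ j, ζ j m‖ ^ 2)) := by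
      gcongr
    rw [h3] at h1
    linarith
  have htel : ∑ m ∈ Finset.range N, (φ (p r m) - φ (p r (m + 1))) ≤ φ x₀ - φ₀ := by
    have := Finset.sum_range_sub' (fun s : ℕ => φ (p r s)) N
    push_cast at this
    rw [this, H.init_of_neg r le_rfl]
    linarith [hφ₀ (p r N)]
  have hsum := Finset.sum_le_sum fun m (_ : m ∈ Finset.range N) => hstep m
  simp only [← Finset.mul_sum, Finset.sum_add_distrib, Finset.sum_sub_distrib] at hsum htel ⊢
  linarith

end IsDelayedDescent

end Path

/-! ### Closing the coupled path inequalities. -/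

/-- In dimensionless form, `Q` stands for root gradients, `S` for displacements, `V` and `w` for
arriving gradients and their changes, `N` and `W` for noise, `φ` for initial gradients. Smallness of
`κ d ^ 3` makes `a`, `b`, `a d` and `b d` small, so `V`, `w` and `S` can be eliminated at the cost
of a quarter of `Q`. -/
theorem combine_path_bounds {d κ a b Q S V N W w φ G : ℝ} (hd : 1 ≤ d) (hκ : 0 ≤ κ)
    (hκd : 100 * κ * d ^ 3 ≤ 1) (ha : a = 64 * κ ^ 2 * d ^ 2) (hb : b = κ + 40 * κ ^ 2 * d ^ 3)
    (hQ : 0 ≤ Q) (hS : 0 ≤ S) (hV : 0 ≤ V) (hN : 0 ≤ N) (hW : 0 ≤ W) (hφ : 0 ≤ φ)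
    (h1 : V ≤ 3 * (Q + S + 2 * d * φ)) (h2 : w ≤ φ + 6 * κ ^ 2 * (V + N) + 6 * S)
    (h3 : S ≤ 2 * κ ^ 2 * W + a * (V + w))
    (h4 : 3 / 4 * Q ≤ G + S + φ / 5 + b * (V + N)) :
    Q / 2 ≤ G + φ / 2 + (κ + 100 * κ ^ 2 * d ^ 3) * N + 3 * κ ^ 2 * W := by
  have hd3 : 1 ≤ d ^ 3 := one_le_pow₀ hd
  have hd1 : d ≤ d ^ 3 := le_self_pow₀ hd (by norm_num)
  have hd2 : d ^ 2 ≤ d ^ 3 := pow_le_pow_right₀ hd (by norm_num)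
  have hk1 : κ * d ≤ 1 / 100 := by
    have := mul_le_mul_of_nonneg_left hd1 hκ
    linarith
  have hk2 : κ * d ^ 2 ≤ 1 / 100 := by
    have := mul_le_mul_of_nonneg_left hd2 hκ
    linarith
  have hk3 : κ * d ^ 3 ≤ 1 / 100 := by linarith
  have hk0 : κ ≤ 1 / 100 := by
    have := mul_le_mul_of_nonneg_left hd3 hκ
    linarith
  have hκ2 : κ ^ 2 ≤ 1 / 10000 := by
    calc κ ^ 2 ≤ (1 / 100) ^ 2 := pow_le_pow_left₀ hκ hk0 2
      _ = _ := by norm_num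
  have p1 : κ ^ 2 * d ^ 2 ≤ 1 / 10000 := by
    calc κ ^ 2 * d ^ 2 = (κ * d) ^ 2 := by ring
      _ ≤ (1 / 100) ^ 2 := pow_le_pow_left₀ (by positivity) hk1 2
      _ = _ := by norm_num
  have p2 : κ ^ 2 * d ^ 3 ≤ 1 / 10000 := by
    calc κ ^ 2 * d ^ 3 = κ * (κ * d ^ 3) := by ring
      _ ≤ 1 / 100 * (1 / 100) := by gcongr
      _ = _ := by norm_num
  have p3 : κ ^ 2 * d ^ 4 ≤ 1 / 10000 := by
    calc κ ^ 2 * d ^ 4 = (κ * d ^ 2) ^ 2 := by ring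
      _ ≤ (1 / 100) ^ 2 := pow_le_pow_left₀ (by positivity) hk2 2
      _ = _ := by norm_num
  have ha0 : 0 ≤ a := by rw [ha]; positivity
  have hb0 : 0 ≤ b := by rw [hb]; positivity
  have ha1 : a ≤ 64 / 10000 := by rw [ha]; linarith
  have haD : a * d ≤ 64 / 10000 := by
    have : a * d = 64 * (κ ^ 2 * d ^ 3) := by rw [ha]; ring
    linarith
  have hb1 : b ≤ 14 / 1000 := by rw [hb]; linarith
  have hbD : b * d ≤ 14 / 1000 := by
    have : b * d = κ * d + 40 * (κ ^ 2 * d ^ 4) := by rw [hb]; ring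
    linarith
  -- The bound on `V` carries a factor `d` at `φ`, so both `c` and `c * d` have to be small.
  have hV' : ∀ c t : ℝ, 0 ≤ c → c ≤ t → c * d ≤ t → c * V ≤ 3 * (t * Q + t * S + 2 * t * φ) := by
    intro c t hc hct hcd
    calc c * V ≤ c * (3 * (Q + S + 2 * d * φ)) := by gcongr
      _ = 3 * (c * Q + c * S + 2 * (c * d) * φ) := by ring
      _ ≤ 3 * (t * Q + t * S + 2 * t * φ) := by gcongr
  have q1 := hV' a _ ha0 ha1 haD
  have q2 := hV' b _ hb0 hb1 hbD
  have q3 : a * φ ≤ 64 / 10000 * φ := by gcongr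
  have q4 : a * S ≤ 64 / 10000 * S := by gcongr
  have q5 : a * (κ ^ 2 * V) ≤ 1 / 10000 * (a * V) := by
    calc a * (κ ^ 2 * V) = κ ^ 2 * (a * V) := by ring
      _ ≤ _ := by gcongr
  have q6 : a * (κ ^ 2 * N) ≤ 64 / 10000 * (κ ^ 2 * N) := by gcongr
  have q7 : κ ^ 2 * N ≤ κ ^ 2 * d ^ 3 * N := by
    rw [mul_right_comm]
    exact le_mul_of_one_le_right (by positivity) hd3
  have q8 : a * w ≤ a * (φ + 6 * κ ^ 2 * (V + N) + 6 * S) := by gcongr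
  have q9 : b * N = κ * N + 40 * (κ ^ 2 * d ^ 3 * N) := by rw [hb]; ring
  have q10 : 0 ≤ κ ^ 2 * W := by positivity
  have q11 : 0 ≤ κ ^ 2 * N := by positivity
  have e1 : (κ + 100 * κ ^ 2 * d ^ 3) * N = κ * N + 100 * (κ ^ 2 * d ^ 3 * N) := by ring
  have e2 : 2 * κ ^ 2 * W = 2 * (κ ^ 2 * W) := by ring
  have e3 : 3 * κ ^ 2 * W = 3 * (κ ^ 2 * W) := by ring
  have e4 : a * (φ + 6 * κ ^ 2 * (V + N) + 6 * S)
    = a * φ + 6 * (a * (κ ^ 2 * V)) + 6 * (a * (κ ^ 2 * N)) + 6 * (a * S) := by ring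
  rw [e1, e3]
  rw [mul_add, e2] at h3
  rw [mul_add] at h4
  -- The self-reference of `S` has a coefficient below `6 / 100` and is moved to the left.
  have hSb : 94 / 100 * S ≤ 2 * (κ ^ 2 * W) + 194 / 10000 * Q + 46 / 1000 * φ
      + 4 / 100 * (κ ^ 2 * d ^ 3 * N) := by linarith
  linarith

namespace IsDelayedDescent

variable {ι : Type*} [Fintype ι] {E : Type*} [NormedAddCommGroup E] [InnerProductSpace ℝ E]
  {L γ : ℝ} {r : ι} {dep : ι → ℕ} {d : ℕ} {h : ι → E → E} {x₀ : E}
  {α : ι → ℕ → ℝ} {β : ι → ℕ → ι → ℝ} {p ζ : ι → ℤ → E}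

/-- The descent inequality along one sample path: apart from a martingale term, the squared
gradients at the root are controlled by the initial gap and the noise. -/
theorem sum_sq_norm_gradient_le (H : IsDelayedDescent L γ r dep (2 * d) h x₀ α β p ζ)
    [Nonempty ι] (hL : 0 < L) (hγ : 0 < γ) (hd : 1 ≤ d)
    (hκ : 100 * (γ * L * Fintype.card ι) * (d : ℝ) ^ 3 ≤ 1) {F : E → E}
    (hF : ∀ x, ∑ j, h j x = (Fintype.card ι : ℝ) • F x)
    (hLF : ∀ x y, ‖F x - F y‖ ≤ L * ‖x - y‖) {φ : E → ℝ} {φ₀ : ℝ}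
    (hφ : ∀ x y, φ y ≤ φ x + inner ℝ (F x) (y - x) + L / 2 * ‖y - x‖ ^ 2)
    (hφ₀ : ∀ x, φ₀ ≤ φ x) (hF₀ : ‖F x₀‖ ^ 2 ≤ 2 * L * (φ x₀ - φ₀)) (N : ℕ) :
    (Fintype.card ι : ℝ) / 2 * ∑ m ∈ Finset.range N, ‖F (p r m)‖ ^ 2
      ≤ (φ x₀ - φ₀) / γ + (∑ j, ‖h j x₀‖ ^ 2) / 2
        + 20 * (d : ℝ) ^ 2 * Fintype.card ι * L * (φ x₀ - φ₀)
        - ∑ m ∈ Finset.range N, inner ℝ (F (p r m)) (∑ j, ζ j m)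
        + (γ * L * Fintype.card ι + 100 * (γ * L * Fintype.card ι) ^ 2 * (d : ℝ) ^ 3)
          / Fintype.card ι * ∑ m ∈ Finset.range N, ‖∑ j, ζ j m‖ ^ 2
        + 3 * (γ * L) ^ 2
          * ∑ m ∈ Finset.range N, ∑ l, ‖lagSum (2 * dep l) (α l) (β l) ζ m‖ ^ 2 := by
  have b1 := H.sum_sq_norm_delayed_le hF N
  have b2 := H.sum_sq_norm_delayed_sub_le N
  have b3 := H.sum_sq_norm_displacement_le N
  have b4 := H.sum_inner_missing_le hLF (by omega) N
  have b5 := H.descent hL hγ.le hF hφ hφ₀ N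
  set n : ℝ := (Fintype.card ι : ℝ) with hn
  have hn0 : (0 : ℝ) < n := by rw [hn]; exact_mod_cast Fintype.card_pos
  set Q := ∑ m ∈ Finset.range N, ‖F (p r m)‖ ^ 2
  set S := ∑ m ∈ Finset.range N, ∑ j, ‖p r m - p j m‖ ^ 2
  set V := ∑ m ∈ Finset.range N, ‖∑ j, delayed dep h p j m‖ ^ 2
  set Ns := ∑ m ∈ Finset.range N, ‖∑ j, ζ j m‖ ^ 2
  set W := ∑ m ∈ Finset.range N, ∑ l, ‖lagSum (2 * dep l) (α l) (β l) ζ m‖ ^ 2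
  set w := ∑ m ∈ Finset.range N, ∑ j, ‖delayed dep h p j m - delayed dep h p j (m - 1)‖ ^ 2
  set I := ∑ m ∈ Finset.range N, inner ℝ (F (p r m)) (∑ j, ζ j m)
  set J := ∑ m ∈ Finset.range N, inner ℝ (F (p r m)) (missing dep h x₀ m)
  set Φ := ∑ j, ‖h j x₀‖ ^ 2
  set Δ := φ x₀ - φ₀
  have hQ : 0 ≤ Q := by positivity
  have hS : 0 ≤ S := by positivity
  have hV : 0 ≤ V := by positivity
  have hNs : 0 ≤ Ns := by positivity
  have hW : 0 ≤ W := by positivity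
  have hΦ : 0 ≤ Φ := by positivity
  push_cast at b1 b3 b4
  -- These scalings remove `n` from all four inequalities. The term `20 d ^ 2 L Δ` is `5 / 2 * (2 d)
  -- ^ 2 * ‖F x₀‖²` with `‖F x₀‖² ≤ 2 L Δ`; the depth bound here is `2 * d`.
  have key := combine_path_bounds (d := (d : ℝ)) (κ := γ * L * n) (Q := Q) (S := L ^ 2 * S / n)
    (V := V / n ^ 2) (N := Ns / n ^ 2) (W := W / n ^ 3) (w := w / n) (φ := Φ / n)
    (G := Δ / (γ * n) - I / n + 20 * (d : ℝ) ^ 2 * L * Δ)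
    (by exact_mod_cast hd) (by positivity) hκ rfl rfl hQ (by positivity) (by positivity)
    (by positivity) (by positivity) (by positivity) ?_ ?_ ?_ ?_
  · have := mul_le_mul_of_nonneg_left key hn0.le
    refine le_trans (le_of_eq ?_) (this.trans (le_of_eq ?_))
    · ring
    · field_simp
      ring
  · rw [div_le_iff₀ (by positivity)]
    refine b1.trans (le_of_eq ?_)
    field_simp
  · rw [div_le_iff₀ (by positivity)]
    refine b2.trans (le_of_eq ?_)
    field_simp
    ring
  · rw [div_le_iff₀ (by positivity)]
    refine (mul_le_mul_of_nonneg_left b3 (sq_nonneg L)).trans (le_of_eq ?_)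
    field_simp
    ring
  · have b6 : γ * J ≤ γ * (1 / 5 * Φ + 5 / 2 * (2 * (d : ℝ)) ^ 2 * n * (2 * L * Δ
        + 2 * L ^ 2 * γ ^ 2 * (2 * d) * (V + Ns))) := by
      refine mul_le_mul_of_nonneg_left (b4.trans ?_) hγ.le
      gcongr
    have b7 : 3 / 4 * (γ * n) * Q ≤ Δ + γ * (L ^ 2 * S) - γ * I
        + γ * (1 / 5 * Φ + 5 / 2 * (2 * (d : ℝ)) ^ 2 * n * (2 * L * Δ
        + 2 * L ^ 2 * γ ^ 2 * (2 * d) * (V + Ns))) + L * γ ^ 2 * (V + Ns) := by linarith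
    rw [← mul_le_mul_iff_right₀ (by positivity : 0 < γ * n)]
    refine le_trans (le_of_eq ?_) (b7.trans (le_of_eq ?_))
    · ring
    · field_simp
      ring

end IsDelayedDescent

/-! ### Second moments -/

section Moments

variable {Ω : Type*} [MeasurableSpace Ω] {P : Measure Ω}
  {E : Type*} [NormedAddCommGroup E]

theorem integrable_sq_norm_of_memLp {u : Ω → E} (hu : MemLp u 2 P) :
    Integrable (fun ω => ‖u ω‖ ^ 2) P :=
  (memLp_two_iff_integrable_sq_norm hu.1).1 hu

theorem memLp_comp_of_lipschitz [IsFiniteMeasure P] {L : ℝ} {F : E → E}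
    (hF : ∀ x y, ‖F x - F y‖ ≤ L * ‖x - y‖) (hc : Continuous F) {u : Ω → E} (hu : MemLp u 2 P) :
    MemLp (fun ω => F (u ω)) 2 P := by
  refine ((memLp_const ‖F 0‖).add (hu.norm.const_mul L)).of_le
    (hc.comp_aestronglyMeasurable hu.1) (.of_forall fun ω => ?_)
  have h1 := hF (u ω) 0
  have h2 := norm_le_norm_add_norm_sub' (F (u ω)) (F 0)
  rw [sub_zero] at h1
  refine le_trans ?_ (le_abs_self _)
  simp only [Pi.add_apply]
  linarith

theorem integral_sq_norm_sub_sub_le {u v w : Ω → E} {K : ℝ} (hu : MemLp u 2 P)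
    (hv : MemLp v 2 P) (hw : MemLp w 2 P) (hu' : ∫ ω, ‖u ω‖ ^ 2 ∂P ≤ K)
    (hv' : ∫ ω, ‖v ω‖ ^ 2 ∂P ≤ K) (hw' : ∫ ω, ‖w ω‖ ^ 2 ∂P ≤ K) :
    ∫ ω, ‖u ω - v ω - w ω‖ ^ 2 ∂P ≤ 9 * K := by
  have i1 := integrable_sq_norm_of_memLp hu
  have i2 := integrable_sq_norm_of_memLp hv
  have i3 := integrable_sq_norm_of_memLp hw
  have i12 : Integrable (fun ω => ‖u ω‖ ^ 2 + ‖v ω‖ ^ 2) P := i1.add i2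
  have h := integral_mono (integrable_sq_norm_of_memLp ((hu.sub hv).sub hw))
    ((i12.add i3).const_mul 3) fun ω => sq_norm_sub_sub_le (u ω) (v ω) (w ω)
  simp only [Pi.sub_apply, Pi.add_apply] at h
  rw [integral_const_mul, integral_add i12 i3, integral_add i1 i2] at h
  linarith

variable [InnerProductSpace ℝ E]

theorem integrable_inner_of_memLp {u v : Ω → E} (hu : MemLp u 2 P) (hv : MemLp v 2 P) :
    Integrable (fun ω => inner ℝ (u ω) (v ω)) P :=
  (hu.norm.integrable_mul hv.norm).mono (hu.1.inner hv.1) (.of_forall fun ω => by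
    simpa using norm_inner_le_norm (𝕜 := ℝ) (u ω) (v ω))

theorem integral_sq_norm_sum_le {κ : Type*} [DecidableEq κ] {s : Finset κ} {u : κ → Ω → E}
    {c : κ → ℝ} {σ : ℝ} (hu : ∀ k, MemLp (u k) 2 P)
    (hortho : ∀ k ∈ s, ∀ k' ∈ s, k ≠ k' → ∫ ω, inner ℝ (u k ω) (u k' ω) ∂P = 0)
    (hσ : ∀ k, ∫ ω, ‖u k ω‖ ^ 2 ∂P ≤ σ ^ 2) (hc : ∀ k, |c k| ≤ 1) :
    ∫ ω, ‖∑ k ∈ s, c k • u k ω‖ ^ 2 ∂P ≤ s.card * σ ^ 2 := by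
  induction s using Finset.induction_on with
  | empty => simp
  | insert a s ha ih =>
    have hs : MemLp (fun ω => ∑ k ∈ s, c k • u k ω) 2 P :=
      memLp_finsetSum s fun k _ => (hu k).const_smul (c k)
    have ha2 : MemLp (fun ω => c a • u a ω) 2 P := (hu a).const_smul (c a)
    have e : ∀ ω, ‖∑ k ∈ insert a s, c k • u k ω‖ ^ 2
        = ‖c a • u a ω‖ ^ 2 + 2 * inner ℝ (c a • u a ω) (∑ k ∈ s, c k • u k ω)
          + ‖∑ k ∈ s, c k • u k ω‖ ^ 2 := fun ω => by
      rw [Finset.sum_insert ha, norm_add_sq_real]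
    have hcross : ∫ ω, inner ℝ (c a • u a ω) (∑ k ∈ s, c k • u k ω) ∂P = 0 := by
      simp_rw [inner_sum, inner_smul_left, inner_smul_right]
      rw [integral_finsetSum]
      · refine Finset.sum_eq_zero fun k hk => ?_
        rw [integral_const_mul, integral_const_mul,
          hortho a (Finset.mem_insert_self a s) k (Finset.mem_insert_of_mem hk), mul_zero, mul_zero]
        rintro rfl
        exact ha hk
      · intro k _
        exact ((integrable_inner_of_memLp (hu a) (hu k)).const_mul _).const_mul _
    have hone : ∫ ω, ‖c a • u a ω‖ ^ 2 ∂P ≤ σ ^ 2 := by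
      simp_rw [norm_smul, mul_pow]
      rw [integral_const_mul]
      have h0 : 0 ≤ ∫ ω, ‖u a ω‖ ^ 2 ∂P := integral_nonneg fun ω => by positivity
      have h1 : ‖c a‖ ^ 2 ≤ 1 := by
        rw [Real.norm_eq_abs]
        exact pow_le_one₀ (abs_nonneg _) (hc a)
      exact (mul_le_of_le_one_left h0 h1).trans (hσ a)
    simp_rw [e]
    rw [integral_add, integral_add, integral_const_mul, hcross, Finset.card_insert_of_notMem ha]
    · have := ih fun k hk k' hk' => hortho k (Finset.mem_insert_of_mem hk) k'
        (Finset.mem_insert_of_mem hk')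
      push_cast
      linarith
    · exact integrable_sq_norm_of_memLp ha2
    · exact (integrable_inner_of_memLp ha2 hs).const_mul 2
    · exact (integrable_sq_norm_of_memLp ha2).add ((integrable_inner_of_memLp ha2 hs).const_mul 2)
    · exact integrable_sq_norm_of_memLp hs

end Moments

/-! ### Stochastic gradients at random points -/

section Oracle

variable {Ω : Type*} [MeasurableSpace Ω] {P : Measure Ω} [IsProbabilityMeasure P] {p : ℕ}
  {S : Type*} [MeasurableSpace S] {D : Measure S} [IsProbabilityMeasure D] {σ : ℝ}
  {h : EuclideanSpace ℝ (Fin p) → ℝ}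
  {g : EuclideanSpace ℝ (Fin p) → S → EuclideanSpace ℝ (Fin p)}
  {x : Ω → EuclideanSpace ℝ (Fin p)} {ξ : Ω → S}

theorem IsSmoothBddBelow.continuous_gradient {L : ℝ} (hh : IsSmoothBddBelow L h) :
    Continuous (gradient h) :=
  (LipschitzWith.of_dist_le' (K := L) fun x y => by
    simpa [dist_eq_norm] using hh.2.2 x y).continuous

/-- By independence the joint law is a product, so Tonelli applies the pointwise variance bound at
each frozen `x`. The Lebesgue form needs no integrability, which is deduced from it. -/
theorem IsUnbiasedOracle.lintegral_noise_le (hg : IsUnbiasedOracle D σ h g)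
    (hh : Measurable (gradient h)) (hx : Measurable x) (hξ : Measurable ξ) (hD : P.map ξ = D)
    (hind : IndepFun x ξ P) :
    ∫⁻ ω, ENNReal.ofReal (‖g (x ω) (ξ ω) - gradient h (x ω)‖ ^ 2) ∂P
      ≤ ENNReal.ofReal (σ ^ 2) := by
  have : IsProbabilityMeasure (P.map x) := Measure.isProbabilityMeasure_map hx.aemeasurable
  have hm : Measurable fun z : EuclideanSpace ℝ (Fin p) × S =>
      ENNReal.ofReal (‖g z.1 z.2 - gradient h z.1‖ ^ 2) :=
    ((hg.1.sub (hh.comp measurable_fst)).norm.pow_const 2).ennreal_ofReal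
  calc ∫⁻ ω, ENNReal.ofReal (‖g (x ω) (ξ ω) - gradient h (x ω)‖ ^ 2) ∂P
      = ∫⁻ z, ENNReal.ofReal (‖g z.1 z.2 - gradient h z.1‖ ^ 2)
          ∂(P.map fun ω => (x ω, ξ ω)) := (lintegral_map hm (hx.prodMk hξ)).symm
    _ = ∫⁻ z, ∫⁻ s, ENNReal.ofReal (‖g z s - gradient h z‖ ^ 2) ∂D ∂(P.map x) := by
        rw [(indepFun_iff_map_prod_eq_prod_map_map hx.aemeasurable hξ.aemeasurable).1 hind, hD,
          lintegral_prod _ hm.aemeasurable]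
    _ ≤ ∫⁻ _z, ENNReal.ofReal (σ ^ 2) ∂(P.map x) := by
        refine lintegral_mono fun z => ?_
        obtain ⟨-, -, h3, h4⟩ := hg.2 z
        rw [← ofReal_integral_eq_lintegral_ofReal h3 (.of_forall fun s => by positivity)]
        exact ENNReal.ofReal_le_ofReal h4
    _ = ENNReal.ofReal (σ ^ 2) := by simp

theorem IsUnbiasedOracle.memLp_noise (hg : IsUnbiasedOracle D σ h g)
    (hh : Measurable (gradient h)) (hx : Measurable x) (hξ : Measurable ξ) (hD : P.map ξ = D)
    (hind : IndepFun x ξ P) :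
    MemLp (fun ω => g (x ω) (ξ ω) - gradient h (x ω)) 2 P := by
  have hm : Measurable fun ω => g (x ω) (ξ ω) - gradient h (x ω) :=
    (hg.1.comp (hx.prodMk hξ)).sub (hh.comp hx)
  rw [memLp_two_iff_integrable_sq_norm hm.aestronglyMeasurable]
  refine ⟨(hm.norm.pow_const 2).aestronglyMeasurable, ?_⟩
  rw [hasFiniteIntegral_iff_ofReal (.of_forall fun ω => by positivity)]
  exact (hg.lintegral_noise_le hh hx hξ hD hind).trans_lt ENNReal.ofReal_lt_top

theorem IsUnbiasedOracle.integral_sq_norm_noise_le (hg : IsUnbiasedOracle D σ h g)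
    (hh : Measurable (gradient h)) (hx : Measurable x) (hξ : Measurable ξ) (hD : P.map ξ = D)
    (hind : IndepFun x ξ P) :
    ∫ ω, ‖g (x ω) (ξ ω) - gradient h (x ω)‖ ^ 2 ∂P ≤ σ ^ 2 := by
  rw [← ENNReal.ofReal_le_ofReal_iff (sq_nonneg σ), ofReal_integral_eq_lintegral_ofReal
    (integrable_sq_norm_of_memLp (hg.memLp_noise hh hx hξ hD hind))
    (.of_forall fun ω => by positivity)]
  exact hg.lintegral_noise_le hh hx hξ hD hind

/-- The vector `v` may be correlated with `x`; what matters is that the pair is independent of `ξ`.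
Fubini then freezes both and the noise averages to zero. -/
theorem IsUnbiasedOracle.integral_inner_noise (hg : IsUnbiasedOracle D σ h g)
    (hh : Measurable (gradient h)) {v : Ω → EuclideanSpace ℝ (Fin p)} (hx : Measurable x)
    (hvm : Measurable v) (hξ : Measurable ξ) (hD : P.map ξ = D)
    (hind : IndepFun (fun ω => (x ω, v ω)) ξ P) (hv : MemLp v 2 P) :
    ∫ ω, inner ℝ (v ω) (g (x ω) (ξ ω) - gradient h (x ω)) ∂P = 0 := by
  have hxv : Measurable fun ω => (x ω, v ω) := hx.prodMk hvm
  have : IsProbabilityMeasure (P.map fun ω => (x ω, v ω)) :=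
    Measure.isProbabilityMeasure_map hxv.aemeasurable
  have hind' : IndepFun x ξ P := hind.comp measurable_fst measurable_id
  have hint := integrable_inner_of_memLp hv (hg.memLp_noise hh hx hξ hD hind')
  set Z : (EuclideanSpace ℝ (Fin p) × EuclideanSpace ℝ (Fin p)) × S → ℝ :=
    fun z => inner ℝ z.1.2 (g z.1.1 z.2 - gradient h z.1.1) with hZ
  have hm : Measurable Z := by
    refine (measurable_snd.comp measurable_fst).inner (Measurable.sub ?_ ?_)
    · exact hg.1.comp ((measurable_fst.comp measurable_fst).prodMk measurable_snd)
    · exact hh.comp (measurable_fst.comp measurable_fst)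
  have hmap := (indepFun_iff_map_prod_eq_prod_map_map hxv.aemeasurable hξ.aemeasurable).1 hind
  rw [hD] at hmap
  have hpair : Measurable fun ω => ((x ω, v ω), ξ ω) := hxv.prodMk hξ
  have h1 : ∫ ω, Z ((x ω, v ω), ξ ω) ∂P = ∫ z, Z z ∂((P.map fun ω => (x ω, v ω)).prod D) := by
    rw [← hmap, integral_map hpair.aemeasurable hm.aestronglyMeasurable]
  have h2 : Integrable Z ((P.map fun ω => (x ω, v ω)).prod D) := by
    rw [← hmap, integrable_map_measure hm.aestronglyMeasurable hpair.aemeasurable]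
    exact hint
  refine h1.trans ?_
  rw [integral_prod _ h2]
  refine integral_eq_zero_of_ae (.of_forall fun z => ?_)
  obtain ⟨g1, g2, -, -⟩ := hg.2 z.1
  simp only [hZ, Pi.zero_apply]
  have h3 := integral_inner (𝕜 := ℝ) (f := fun s => g z.1 s - gradient h z.1)
    (g1.sub (integrable_const _)) z.2
  rw [h3, integral_sub g1 (integrable_const _), g2]
  simp

end Oracle

/-! ### The stochastic process -/

/-- The `σ`-algebra generated by the samples with index in `A`. -/
abbrev sampleSigma {Ω κ : Type*} {S : κ → Type*} [∀ q, MeasurableSpace (S q)]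
    (ξ : ∀ q, Ω → S q) (A : Set κ) : MeasurableSpace Ω :=
  ⨆ q ∈ A, MeasurableSpace.comap (ξ q) inferInstance

section SampleSigma

variable {Ω κ : Type*} {S : κ → Type*} [∀ q, MeasurableSpace (S q)] {ξ : ∀ q, Ω → S q}

theorem sampleSigma_mono {A A' : Set κ} (h : A ⊆ A') : sampleSigma ξ A ≤ sampleSigma ξ A' :=
  biSup_mono h

theorem measurable_of_mem_sampleSigma {A : Set κ} {q : κ} (hq : q ∈ A) :
    Measurable[sampleSigma ξ A] (ξ q) :=
  Measurable.of_comap_le (le_biSup (fun q => MeasurableSpace.comap (ξ q) inferInstance) hq)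

theorem sampleSigma_le [MeasurableSpace Ω] (hξ : ∀ q, Measurable (ξ q)) (A : Set κ) :
    sampleSigma ξ A ≤ ‹MeasurableSpace Ω› :=
  iSup₂_le fun q _ => (hξ q).comap_le

theorem indepFun_sample [MeasurableSpace Ω] {P : Measure Ω} (hξ : ∀ q, Measurable (ξ q))
    (hind : iIndepFun ξ P) {A : Set κ} {q : κ} (hq : q ∉ A) {T : Type*} [MeasurableSpace T]
    {Z : Ω → T} (hZ : Measurable[sampleSigma ξ A] Z) : IndepFun Z (ξ q) P := by
  have h1 := indep_iSup_of_disjoint (fun q => (hξ q).comap_le) hind.iIndep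
    (Set.disjoint_singleton_right.2 hq)
  rw [iSup_singleton] at h1
  rw [IndepFun_iff_Indep]
  exact indep_of_indep_of_le_left h1 hZ.comap_le

end SampleSigma

/-! ### Gradient noise in arrival time. -/

section Noise

variable {Ω ι : Type*} {Ξ : ι → Type*} {p : ℕ} {dep : ι → ℕ}
  {f : ι → EuclideanSpace ℝ (Fin p) → ℝ}
  {g : ∀ i, EuclideanSpace ℝ (Fin p) → Ξ i → EuclideanSpace ℝ (Fin p)}
  {ξ : ∀ (_ : ℕ) (i : ι), Ω → Ξ i} {x : ℕ → ι → Ω → EuclideanSpace ℝ (Fin p)}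

/-- The gradient noise of node `i` at time `t`. -/
noncomputable def noise (f : ι → EuclideanSpace ℝ (Fin p) → ℝ)
    (g : ∀ i, EuclideanSpace ℝ (Fin p) → Ξ i → EuclideanSpace ℝ (Fin p))
    (ξ : ∀ (_ : ℕ) (i : ι), Ω → Ξ i) (x : ℕ → ι → Ω → EuclideanSpace ℝ (Fin p))
    (t : ℕ) (i : ι) (ω : Ω) : EuclideanSpace ℝ (Fin p) :=
  g i (x t i ω) (ξ t i ω) - gradient (f i) (x t i ω)

/-- The noise of node `j` that reaches the root at time `m`. -/
noncomputable def arrivingNoise (dep : ι → ℕ)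
    (f : ι → EuclideanSpace ℝ (Fin p) → ℝ)
    (g : ∀ i, EuclideanSpace ℝ (Fin p) → Ξ i → EuclideanSpace ℝ (Fin p))
    (ξ : ∀ (_ : ℕ) (i : ι), Ω → Ξ i) (x : ℕ → ι → Ω → EuclideanSpace ℝ (Fin p))
    (ω : Ω) (j : ι) (m : ℤ) : EuclideanSpace ℝ (Fin p) :=
  arrival dep (fun t i => noise f g ξ x t i ω) j m

theorem arrivingNoise_eq (dep : ι → ℕ) (j : ι) (m : ℤ) :
    (∀ ω, arrivingNoise dep f g ξ x ω j m = 0) ∨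
      (dep j ≤ m ∧ ∀ ω, arrivingNoise dep f g ξ x ω j m = noise f g ξ x (m - dep j).toNat j ω) := by
  by_cases hm : m < dep j
  · exact Or.inl fun ω => if_pos hm
  · exact Or.inr ⟨by omega, fun ω => if_neg hm⟩

theorem lagSum_arrivingNoise_eq [Fintype ι] (R : ℕ) (α : ℕ → ℝ) (β : ℕ → ι → ℝ) (a : ℤ) (ω : Ω) :
    lagSum R α β (arrivingNoise dep f g ξ x ω) a
      = ∑ k ∈ Finset.range R, ∑ j, α k • arrivingNoise dep f g ξ x ω j (a - 1 - k)
        - ∑ k ∈ Finset.range R, ∑ j, β k j • arrivingNoise dep f g ξ x ω j (a - 1 - k)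
        - ∑ k ∈ Finset.range R, ∑ j, (-β k j) • arrivingNoise dep f g ξ x ω j (a - 2 - k) := by
  rw [lagSum, ← Finset.sum_sub_distrib, ← Finset.sum_sub_distrib]
  refine Finset.sum_congr rfl fun k _ => ?_
  rw [Finset.smul_sum]
  simp only [smul_sub, Finset.sum_sub_distrib, neg_smul, Finset.sum_neg_distrib]
  abel

end Noise

/-! ### Measurability, orthogonality and moments of the process. -/

section Stochastic

variable {Ω : Type*} [MeasurableSpace Ω] {ι : Type*} [Fintype ι] [DecidableEq ι]
  {Ξ : ι → Type*} [∀ i, MeasurableSpace (Ξ i)] {p : ℕ}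

/-- The push-pull recursion on a rooted tree driven by independent samples `ξ t i` of law `D i`
through unbiased gradient oracles `g i` of the smooth functions `f i`. -/
structure IsStochasticPushPull (P : Measure Ω) (L σ γ : ℝ) (r : ι) (par : ι → ι) (dep : ι → ℕ)
    (f : ι → EuclideanSpace ℝ (Fin p) → ℝ)
    (g : ∀ i, EuclideanSpace ℝ (Fin p) → Ξ i → EuclideanSpace ℝ (Fin p))
    (D : ∀ i, Measure (Ξ i)) (ξ : ∀ (_ : ℕ) (i : ι), Ω → Ξ i) (x₀ : EuclideanSpace ℝ (Fin p))
    (x y : ℕ → ι → Ω → EuclideanSpace ℝ (Fin p)) : Prop where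
  tree : IsRootedTree r par dep
  smooth : ∀ i, IsSmoothBddBelow L (f i)
  oracle : ∀ i, IsUnbiasedOracle (D i) σ (f i) (g i)
  measurable_sample : ∀ t i, Measurable (ξ t i)
  law : ∀ t i, P.map (ξ t i) = D i
  indep : iIndepFun (fun q : ℕ × ι => ξ q.1 q.2) P
  recursion : ∀ ω, IsPushPull par γ x₀ (fun t i => g i (x t i ω) (ξ t i ω))
    (fun t i => x t i ω) (fun t i => y t i ω)

namespace IsStochasticPushPull

variable {P : Measure Ω} {L σ γ : ℝ} {r : ι} {par : ι → ι} {dep : ι → ℕ}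
  {f : ι → EuclideanSpace ℝ (Fin p) → ℝ}
  {g : ∀ i, EuclideanSpace ℝ (Fin p) → Ξ i → EuclideanSpace ℝ (Fin p)}
  {D : ∀ i, Measure (Ξ i)} {ξ : ∀ (_ : ℕ) (i : ι), Ω → Ξ i} {x₀ : EuclideanSpace ℝ (Fin p)}
  {x y : ℕ → ι → Ω → EuclideanSpace ℝ (Fin p)}

theorem measurable_gradient (H : IsStochasticPushPull P L σ γ r par dep f g D ξ x₀ x y) (i : ι) :
    Measurable (gradient (f i)) := (H.smooth i).continuous_gradient.measurable

theorem dep_par_le (H : IsStochasticPushPull P L σ γ r par dep f g D ξ x₀ x y) (i : ι) :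
    dep (par i) ≤ dep i ∧ dep i ≤ dep (par i) + 1 := by
  by_cases hi : i = r
  · rw [hi, H.tree.par_root]
    omega
  · have := H.tree.dep_succ i hi
    omega

/-- The state at a node depends only on the samples that are at the root strictly before the
current sample of the node. -/
theorem measurable_state (H : IsStochasticPushPull P L σ γ r par dep f g D ξ x₀ x y) (t : ℕ) :
    (∀ i, Measurable[sampleSigma (fun q : ℕ × ι => ξ q.1 q.2)
        {q | q.1 + dep q.2 + 1 ≤ t + dep i}] (x t i)) ∧
      ∀ i, Measurable[sampleSigma (fun q : ℕ × ι => ξ q.1 q.2)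
        {q | q.1 + dep q.2 ≤ t + dep i}] (y t i) := by
  have hg : ∀ (A : Set (ℕ × ι)) (s : ℕ) (i : ι), (s, i) ∈ A →
      Measurable[sampleSigma (fun q : ℕ × ι => ξ q.1 q.2) A] (x s i) →
      Measurable[sampleSigma (fun q : ℕ × ι => ξ q.1 q.2) A]
        (fun ω => g i (x s i ω) (ξ s i ω)) := fun A s i hA hx =>
    (H.oracle i).1.comp
      (hx.prodMk (measurable_of_mem_sampleSigma (ξ := fun q : ℕ × ι => ξ q.1 q.2) hA))
  induction t with
  | zero =>
    have hx : ∀ i, x 0 i = fun _ => x₀ := fun i => funext fun ω => (H.recursion ω).x_zero i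
    have hy : ∀ i, y 0 i = fun ω => g i (x 0 i ω) (ξ 0 i ω) := fun i =>
      funext fun ω => (H.recursion ω).y_zero i
    refine ⟨fun i => hx i ▸ measurable_const, fun i => ?_⟩
    rw [hy]
    exact hg _ 0 i (by simp) (hx i ▸ measurable_const)
  | succ t ih =>
    have hx : ∀ i, x (t + 1) i = fun ω => x t (par i) ω - γ • y t (par i) ω := fun i =>
      funext fun ω => (H.recursion ω).x_succ t i
    have hy : ∀ i, y (t + 1) i = fun ω =>
        ∑ j ∈ Finset.univ.filter (fun j => par j = i), y t j ω
          + g i (x (t + 1) i ω) (ξ (t + 1) i ω) - g i (x t i ω) (ξ t i ω) := fun i =>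
      funext fun ω => (H.recursion ω).y_succ t i
    have hx1 : ∀ i, Measurable[sampleSigma (fun q : ℕ × ι => ξ q.1 q.2)
        {q | q.1 + dep q.2 + 1 ≤ t + 1 + dep i}] (x (t + 1) i) := by
      intro i
      have hd := H.dep_par_le i
      rw [hx]
      refine Measurable.sub ((ih.1 (par i)).mono (sampleSigma_mono ?_) le_rfl)
        (((ih.2 (par i)).mono (sampleSigma_mono ?_) le_rfl).const_smul γ)
      · intro q hq
        simp only [Set.mem_ofPred_eq] at hq ⊢
        omega
      · intro q hq
        simp only [Set.mem_ofPred_eq] at hq ⊢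
        omega
    refine ⟨hx1, fun i => ?_⟩
    rw [hy]
    refine Measurable.sub (Measurable.add (Finset.measurable_sum _ fun j hj => ?_)
      (hg _ _ i (by simp) ((hx1 i).mono (sampleSigma_mono ?_) le_rfl)))
      (hg _ _ i (by simp) ((ih.1 i).mono (sampleSigma_mono ?_) le_rfl))
    -- Passing from a child at time `t` to its parent at time `t + 1` does not lower the
    -- arrival-time bound, since depth drops by at most one.
    · have hd := H.dep_par_le j
      rw [(Finset.mem_filter.1 hj).2] at hd
      refine (ih.2 j).mono (sampleSigma_mono ?_) le_rfl
      intro q hq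
      simp only [Set.mem_ofPred_eq] at hq ⊢
      omega
    · intro q hq
      simp only [Set.mem_ofPred_eq] at hq ⊢
      omega
    · intro q hq
      simp only [Set.mem_ofPred_eq] at hq ⊢
      omega

theorem sampleSigma_le (H : IsStochasticPushPull P L σ γ r par dep f g D ξ x₀ x y)
    (A : Set (ℕ × ι)) :
    sampleSigma (fun q : ℕ × ι => ξ q.1 q.2) A ≤ ‹MeasurableSpace Ω› :=
  BTPP.sampleSigma_le (fun q => H.measurable_sample q.1 q.2) A

theorem measurable_x (H : IsStochasticPushPull P L σ γ r par dep f g D ξ x₀ x y) (t : ℕ) (i : ι) :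
    Measurable (x t i) := ((H.measurable_state t).1 i).mono (H.sampleSigma_le _) le_rfl

theorem indepFun_sample (H : IsStochasticPushPull P L σ γ r par dep f g D ξ x₀ x y)
    {t : ℕ} {i : ι} {A : Set (ℕ × ι)} (hA : (t, i) ∉ A) {T : Type*} [MeasurableSpace T] {Z : Ω → T}
    (hZ : Measurable[sampleSigma (fun q : ℕ × ι => ξ q.1 q.2) A] Z) : IndepFun Z (ξ t i) P :=
  BTPP.indepFun_sample (ξ := fun q : ℕ × ι => ξ q.1 q.2) (q := (t, i))
    (fun q => H.measurable_sample q.1 q.2) H.indep hA hZ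

variable [IsProbabilityMeasure P]

theorem memLp_gradient (H : IsStochasticPushPull P L σ γ r par dep f g D ξ x₀ x y) (i : ι)
    {u : Ω → EuclideanSpace ℝ (Fin p)} (hu : MemLp u 2 P) :
    MemLp (fun ω => gradient (f i) (u ω)) 2 P :=
  memLp_comp_of_lipschitz (H.smooth i).2.2 (H.smooth i).continuous_gradient hu

variable [∀ i, IsProbabilityMeasure (D i)]

theorem memLp_noise (H : IsStochasticPushPull P L σ γ r par dep f g D ξ x₀ x y) (t : ℕ) (i : ι) :
    MemLp (noise f g ξ x t i) 2 P :=
  (H.oracle i).memLp_noise (H.measurable_gradient i) (H.measurable_x t i)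
    (H.measurable_sample t i) (H.law t i)
    (H.indepFun_sample (by simp) ((H.measurable_state t).1 i))

theorem integral_sq_norm_noise_le (H : IsStochasticPushPull P L σ γ r par dep f g D ξ x₀ x y)
    (t : ℕ) (i : ι) : ∫ ω, ‖noise f g ξ x t i ω‖ ^ 2 ∂P ≤ σ ^ 2 :=
  (H.oracle i).integral_sq_norm_noise_le (H.measurable_gradient i) (H.measurable_x t i)
    (H.measurable_sample t i) (H.law t i)
    (H.indepFun_sample (by simp) ((H.measurable_state t).1 i))

theorem memLp_state (H : IsStochasticPushPull P L σ γ r par dep f g D ξ x₀ x y) (t : ℕ) :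
    (∀ i, MemLp (x t i) 2 P) ∧ ∀ i, MemLp (y t i) 2 P := by
  have hg : ∀ (s : ℕ) (i : ι), MemLp (x s i) 2 P →
      MemLp (fun ω => g i (x s i ω) (ξ s i ω)) 2 P := fun s i hx => by
    refine ((H.memLp_noise s i).add (H.memLp_gradient i hx)).ae_eq (.of_forall fun ω => ?_)
    simp [noise]
  induction t with
  | zero =>
    have hx : ∀ i, MemLp (x 0 i) 2 P := fun i => by
      rw [show x 0 i = fun _ => x₀ from funext fun ω => (H.recursion ω).x_zero i]
      exact memLp_const x₀
    refine ⟨hx, fun i => ?_⟩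
    rw [show y 0 i = fun ω => g i (x 0 i ω) (ξ 0 i ω) from
      funext fun ω => (H.recursion ω).y_zero i]
    exact hg 0 i (hx i)
  | succ t ih =>
    have hx : ∀ i, MemLp (x (t + 1) i) 2 P := fun i => by
      rw [show x (t + 1) i = fun ω => x t (par i) ω - γ • y t (par i) ω from
        funext fun ω => (H.recursion ω).x_succ t i]
      exact (ih.1 _).sub ((ih.2 _).const_smul γ)
    refine ⟨hx, fun i => ?_⟩
    rw [show y (t + 1) i = fun ω =>
        ∑ j ∈ Finset.univ.filter (fun j => par j = i), y t j ω
          + g i (x (t + 1) i ω) (ξ (t + 1) i ω) - g i (x t i ω) (ξ t i ω) from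
      funext fun ω => (H.recursion ω).y_succ t i]
    exact ((memLp_finsetSum _ fun j _ => ih.2 j).add (hg _ i (hx i))).sub (hg _ i (ih.1 i))

/-- The noise of a sample is orthogonal to everything that depends only on other samples that
reach the root no later. -/
theorem integral_inner_noise (H : IsStochasticPushPull P L σ γ r par dep f g D ξ x₀ x y)
    {t : ℕ} {i : ι} {v : Ω → EuclideanSpace ℝ (Fin p)} (hv : MemLp v 2 P)
    (hvm : Measurable[sampleSigma (fun q : ℕ × ι => ξ q.1 q.2)
      {q | q ≠ (t, i) ∧ q.1 + dep q.2 ≤ t + dep i}] v) :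
    ∫ ω, inner ℝ (v ω) (noise f g ξ x t i ω) ∂P = 0 := by
  refine (H.oracle i).integral_inner_noise (H.measurable_gradient i) (H.measurable_x t i)
    (hvm.mono (H.sampleSigma_le _) le_rfl) (H.measurable_sample t i) (H.law t i)
    (H.indepFun_sample (A := {q | q ≠ (t, i) ∧ q.1 + dep q.2 ≤ t + dep i}) (by simp)
      (Measurable.prodMk (((H.measurable_state t).1 i).mono (sampleSigma_mono ?_) le_rfl) hvm)) hv
  intro q hq
  simp only [Set.mem_ofPred_eq] at hq ⊢
  refine ⟨?_, by omega⟩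
  rintro rfl
  simp only at hq
  omega

theorem integral_inner_noise_noise (H : IsStochasticPushPull P L σ γ r par dep f g D ξ x₀ x y)
    {t s : ℕ} {i j : ι} (hne : (s, j) ≠ (t, i)) :
    ∫ ω, inner ℝ (noise f g ξ x s j ω) (noise f g ξ x t i ω) ∂P = 0 := by
  -- The later arrival plays the role of fresh noise. Ties are harmless: the other noise uses its
  -- own sample and strictly earlier arrivals.
  wlog hle : s + dep j ≤ t + dep i generalizing s t i j
  · have := this hne.symm (by omega)
    simp_rw [real_inner_comm] at this ⊢
    exact this
  refine H.integral_inner_noise (H.memLp_noise s j) ?_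
  have hx : Measurable[sampleSigma (fun q : ℕ × ι => ξ q.1 q.2)
      {q | q ≠ (t, i) ∧ q.1 + dep q.2 ≤ t + dep i}] (x s j) := by
    refine ((H.measurable_state s).1 j).mono (sampleSigma_mono ?_) le_rfl
    intro q hq
    simp only [Set.mem_ofPred_eq] at hq ⊢
    refine ⟨?_, by omega⟩
    rintro rfl
    simp only at hq
    omega
  have hξ := measurable_of_mem_sampleSigma (ξ := fun q : ℕ × ι => ξ q.1 q.2)
    (A := {q | q ≠ (t, i) ∧ q.1 + dep q.2 ≤ t + dep i}) (q := (s, j)) ⟨hne, hle⟩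
  exact Measurable.sub ((H.oracle j).1.comp (hx.prodMk hξ)) ((H.measurable_gradient j).comp hx)

theorem memLp_arrivingNoise (H : IsStochasticPushPull P L σ γ r par dep f g D ξ x₀ x y)
    (j : ι) (m : ℤ) : MemLp (fun ω => arrivingNoise dep f g ξ x ω j m) 2 P := by
  obtain h | ⟨-, h⟩ := arrivingNoise_eq (f := f) (g := g) (ξ := ξ) (x := x) dep j m
  · simp only [h]
    exact memLp_const 0
  · simp only [h]
    exact H.memLp_noise _ j

theorem integral_sq_norm_arrivingNoise_le
    (H : IsStochasticPushPull P L σ γ r par dep f g D ξ x₀ x y) (j : ι) (m : ℤ) :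
    ∫ ω, ‖arrivingNoise dep f g ξ x ω j m‖ ^ 2 ∂P ≤ σ ^ 2 := by
  obtain h | ⟨-, h⟩ := arrivingNoise_eq (f := f) (g := g) (ξ := ξ) (x := x) dep j m
  · simp [h, sq_nonneg]
  · simp only [h]
    exact H.integral_sq_norm_noise_le _ j

theorem integral_inner_arrivingNoise
    (H : IsStochasticPushPull P L σ γ r par dep f g D ξ x₀ x y) {j j' : ι} {m m' : ℤ}
    (hne : (j, m) ≠ (j', m')) :
    ∫ ω, inner ℝ (arrivingNoise dep f g ξ x ω j m) (arrivingNoise dep f g ξ x ω j' m') ∂P = 0 := by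
  obtain h | ⟨hm, h⟩ := arrivingNoise_eq (f := f) (g := g) (ξ := ξ) (x := x) dep j m
  · simp [h]
  obtain h' | ⟨hm', h'⟩ := arrivingNoise_eq (f := f) (g := g) (ξ := ξ) (x := x) dep j' m'
  · simp [h']
  simp only [h, h']
  refine H.integral_inner_noise_noise fun heq => hne ?_
  rw [Prod.mk.injEq] at heq ⊢
  obtain ⟨h1, rfl⟩ := heq
  exact ⟨rfl, by omega⟩

/-- Second moments of linear combinations of arriving noise over a window of lags. -/
theorem integral_sq_norm_window_le (H : IsStochasticPushPull P L σ γ r par dep f g D ξ x₀ x y)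
    (R : ℕ) {c : ℕ → ι → ℝ} (hc : ∀ k j, |c k j| ≤ 1) (a : ℤ) :
    MemLp (fun ω => ∑ k ∈ Finset.range R, ∑ j, c k j • arrivingNoise dep f g ξ x ω j (a - k)) 2 P ∧
    ∫ ω, ‖∑ k ∈ Finset.range R, ∑ j, c k j • arrivingNoise dep f g ξ x ω j (a - k)‖ ^ 2 ∂P
      ≤ Fintype.card ι * R * σ ^ 2 := by
  refine ⟨memLp_finsetSum _ fun k _ => memLp_finsetSum _ fun j _ =>
    (H.memLp_arrivingNoise j _).const_smul (c k j), ?_⟩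
  have := integral_sq_norm_sum_le (P := P) (s := Finset.range R ×ˢ (Finset.univ : Finset ι))
    (u := fun q ω => arrivingNoise dep f g ξ x ω q.2 (a - q.1)) (c := fun q => c q.1 q.2) (σ := σ)
    (fun q => H.memLp_arrivingNoise _ _) (fun q _ q' _ hq => H.integral_inner_arrivingNoise ?_)
    (fun q => H.integral_sq_norm_arrivingNoise_le _ _) (fun q => hc _ _)
  · simp only [Finset.sum_product, Finset.card_product, Finset.card_range, Finset.card_univ] at this
    refine this.trans (le_of_eq ?_)
    push_cast
    ring
  · contrapose! hq
    rw [Prod.mk.injEq] at hq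
    exact Prod.ext (by omega) hq.1

theorem memLp_sum_arrivingNoise (H : IsStochasticPushPull P L σ γ r par dep f g D ξ x₀ x y)
    (m : ℤ) : MemLp (fun ω => ∑ j, arrivingNoise dep f g ξ x ω j m) 2 P :=
  memLp_finsetSum _ fun j _ => H.memLp_arrivingNoise j m

theorem integral_sq_norm_sum_arrivingNoise_le
    (H : IsStochasticPushPull P L σ γ r par dep f g D ξ x₀ x y) (m : ℤ) :
    ∫ ω, ‖∑ j, arrivingNoise dep f g ξ x ω j m‖ ^ 2 ∂P ≤ Fintype.card ι * σ ^ 2 := by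
  simpa using (H.integral_sq_norm_window_le 1 (c := fun _ _ => 1) (by simp) m).2

/-- Linear in `R`, unlike the pathwise bound: each of the three windows is a sum of orthogonal terms
with coefficients in `[-1, 1]`. The factor 9 is the price of splitting into three. -/
theorem integral_sq_norm_lagSum_le (H : IsStochasticPushPull P L σ γ r par dep f g D ξ x₀ x y)
    (R : ℕ) {α : ℕ → ℝ} {β : ℕ → ι → ℝ} (hα : ∀ k, 0 ≤ α k ∧ α k ≤ 1)
    (hβ : ∀ k j, 0 ≤ β k j ∧ β k j ≤ 1) (a : ℤ) :
    MemLp (fun ω => lagSum R α β (arrivingNoise dep f g ξ x ω) a) 2 P ∧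
    ∫ ω, ‖lagSum R α β (arrivingNoise dep f g ξ x ω) a‖ ^ 2 ∂P
      ≤ 9 * Fintype.card ι * R * σ ^ 2 := by
  obtain ⟨m1, h1⟩ := H.integral_sq_norm_window_le R (c := fun k _ => α k)
    (fun k _ => abs_le.2 ⟨by linarith [(hα k).1], (hα k).2⟩) (a - 1)
  obtain ⟨m2, h2⟩ := H.integral_sq_norm_window_le R (c := β)
    (fun k j => abs_le.2 ⟨by linarith [(hβ k j).1], (hβ k j).2⟩) (a - 1)
  obtain ⟨m3, h3⟩ := H.integral_sq_norm_window_le R (c := fun k j => -β k j)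
    (fun k j => abs_le.2 ⟨by linarith [(hβ k j).2], by linarith [(hβ k j).1]⟩) (a - 2)
  simp only [lagSum_arrivingNoise_eq]
  have hm := (m1.sub m2).sub m3
  refine ⟨hm, ?_⟩
  refine (integral_sq_norm_sub_sub_le m1 m2 m3 h1 h2 h3).trans (le_of_eq ?_)
  ring

/-- The total noise arriving at the root at time `m` is orthogonal to functions of the state of
the root. -/
theorem integral_inner_sum_arrivingNoise
    (H : IsStochasticPushPull P L σ γ r par dep f g D ξ x₀ x y)
    {F : EuclideanSpace ℝ (Fin p) → EuclideanSpace ℝ (Fin p)}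
    (hF : ∀ u v, ‖F u - F v‖ ≤ L * ‖u - v‖) (hc : Continuous F) (m : ℕ) :
    ∫ ω, inner ℝ (F (x m r ω)) (∑ j, arrivingNoise dep f g ξ x ω j m) ∂P = 0 := by
  have hv : MemLp (fun ω => F (x m r ω)) 2 P :=
    memLp_comp_of_lipschitz hF hc ((H.memLp_state m).1 r)
  simp_rw [inner_sum]
  rw [integral_finsetSum _ fun j _ =>
    integrable_inner_of_memLp hv (H.memLp_arrivingNoise j m)]
  refine Finset.sum_eq_zero fun j _ => ?_
  obtain h | ⟨hm, h⟩ := arrivingNoise_eq (f := f) (g := g) (ξ := ξ) (x := x) dep j (m : ℤ)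
  · simp [h]
  simp only [h]
  refine H.integral_inner_noise hv (hc.measurable.comp
    (((H.measurable_state m).1 r).mono (sampleSigma_mono ?_) le_rfl))
  intro q hq
  simp only [Set.mem_ofPred_eq, H.tree.dep_root] at hq ⊢
  refine ⟨?_, by omega⟩
  rintro rfl
  simp only at hq
  omega

end IsStochasticPushPull

end Stochastic

/-! ### The rate in expectation -/

theorem integral_le_of_le_combination {Ω : Type*} [MeasurableSpace Ω] {P : Measure Ω}
    [IsProbabilityMeasure P] {q a b w : Ω → ℝ} (hq : Integrable q P) (ha : Integrable a P)
    (hb : Integrable b P) (hw : Integrable w P) {C k k' : ℝ}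
    (h : ∀ ω, q ω ≤ C - a ω + k * b ω + k' * w ω) :
    ∫ ω, q ω ∂P ≤ C - ∫ ω, a ω ∂P + k * ∫ ω, b ω ∂P + k' * ∫ ω, w ω ∂P := by
  have i1 : Integrable (fun ω => C - a ω) P := (integrable_const C).sub ha
  have i2 : Integrable (fun ω => C - a ω + k * b ω) P := i1.add (hb.const_mul k)
  refine (integral_mono hq (i2.add (hw.const_mul k')) h).trans (le_of_eq ?_)
  simp only [Pi.add_apply]
  rw [integral_add i2 (hw.const_mul k'), integral_add i1 (hb.const_mul k),
    integral_sub (integrable_const C) ha, integral_const_mul, integral_const_mul]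
  simp

section Rate

variable {Ω : Type*} [MeasurableSpace Ω] {P : Measure Ω}
  {n : ℕ} {Ξ : Fin n → Type*} [∀ i, MeasurableSpace (Ξ i)] {p : ℕ}
  {L σ γ : ℝ} {r : Fin n} {par : Fin n → Fin n} {dep : Fin n → ℕ}
  {f : Fin n → EuclideanSpace ℝ (Fin p) → ℝ}
  {g : ∀ i, EuclideanSpace ℝ (Fin p) → Ξ i → EuclideanSpace ℝ (Fin p)}
  {D : ∀ i, Measure (Ξ i)}
  {ξ : ∀ (_ : ℕ) (i : Fin n), Ω → Ξ i} {x₀ : EuclideanSpace ℝ (Fin p)}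
  {x y : ℕ → Fin n → Ω → EuclideanSpace ℝ (Fin p)}

theorem IsStochasticPushPull.isDelayedDescent
    (H : IsStochasticPushPull P L σ γ r par dep f g D ξ x₀ x y) {d : ℕ} (hd : ∀ j, dep j ≤ d)
    {α : Fin n → ℕ → ℝ} {β : Fin n → ℕ → Fin n → ℝ} (hα : ∀ l k, 0 ≤ α l k ∧ α l k ≤ 1)
    (hβ : ∀ l k j, 0 ≤ β l k j ∧ β l k j ≤ 1)
    (hrep : ∀ l, ∀ (γ : ℝ) (x₀ : EuclideanSpace ℝ (Fin p))
      (g x y : ℕ → Fin n → EuclideanSpace ℝ (Fin p)), IsPushPull par γ x₀ g x y →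
        ∀ a : ℤ, aligned dep x r a - aligned dep x l a
          = -(γ • lagSum (2 * dep l) (α l) (β l) (arrival dep g) a)) (ω : Ω) :
    IsDelayedDescent L γ r dep d (fun j => gradient (f j)) x₀ α β
      (aligned dep fun t i => x t i ω) (arrivingNoise dep f g ξ x ω) := by
  -- Each arriving stochastic gradient is the true gradient at the aligned state plus its noise.
  have hsplit : arrival dep (fun t i => g i (x t i ω) (ξ t i ω)) = fun j m =>
      delayed dep (fun j => gradient (f j)) (aligned dep fun t i => x t i ω) j m
        + arrivingNoise dep f g ξ x ω j m := by
    funext j m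
    rw [arrival, delayed, arrivingNoise, arrival]
    split_ifs
    · simp
    · simp [noise, aligned]
  exact {
    lipschitz := fun j => (H.smooth j).2.2
    dep_le := hd
    init := fun j m hm => (H.recursion ω).aligned_of_le hm
    noise_of_lt := fun j m hm => arrival_of_lt _ hm
    step := fun a => by
      rw [(H.recursion ω).aligned_root_add_one H.tree, hsplit]
    coeff := hα
    coeff' := hβ
    displacement := fun l a => by
      rw [hrep l _ _ _ _ _ (H.recursion ω), hsplit] }

variable [NeZero n]

theorem sum_gradient_eq (hf : ∀ i, IsSmoothBddBelow L (f i)) (u : EuclideanSpace ℝ (Fin p)) :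
    ∑ j, gradient (f j) u = (n : ℝ) • gradient (objective f) u := by
  have hn : (n : ℝ) ≠ 0 := by exact_mod_cast NeZero.ne n
  rw [(hasGradientAt_objective (fun i => (hf i).2.1) u).gradient, smul_smul, mul_one_div_cancel hn,
    one_smul]

theorem initialGap_nonneg (hf : ∀ i, IsSmoothBddBelow L (f i)) : 0 ≤ initialGap f x₀ :=
  sub_nonneg.2 (ciInf_le (isSmoothBddBelow_objective hf).1 x₀)

variable [IsProbabilityMeasure P] [∀ i, IsProbabilityMeasure (D i)]

theorem IsStochasticPushPull.integrable_sq_norm_gradient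
    (H : IsStochasticPushPull P L σ γ r par dep f g D ξ x₀ x y) (t : ℕ) (i : Fin n) :
    Integrable (fun ω => ‖gradient (objective f) (x t i ω)‖ ^ 2) P := by
  have hs := isSmoothBddBelow_objective H.smooth
  exact integrable_sq_norm_of_memLp
    (memLp_comp_of_lipschitz hs.2.2 hs.continuous_gradient ((H.memLp_state t).1 i))

theorem IsStochasticPushPull.sum_integral_sq_norm_gradient_le
    (H : IsStochasticPushPull P L σ γ r par dep f g D ξ x₀ x y) (hL : 0 < L) (hγ : 0 < γ) {d : ℕ}
    (hd : 1 ≤ d) (hdep : ∀ j, dep j ≤ 2 * d) (hκ : 100 * (γ * L * n) * (d : ℝ) ^ 3 ≤ 1) (N : ℕ) :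
    (n : ℝ) / 2 * ∑ m ∈ Finset.range N, ∫ ω, ‖gradient (objective f) (x m r ω)‖ ^ 2 ∂P
      ≤ initialGap f x₀ / γ + (∑ j, ‖gradient (f j) x₀‖ ^ 2) / 2
        + 20 * (d : ℝ) ^ 2 * n * L * initialGap f x₀
        + N * σ ^ 2 * (γ * L * n + 208 * (γ * L * n) ^ 2 * (d : ℝ) ^ 3) := by
  -- The coefficients are fixed before `ω`, hence deterministic; the orthogonality argument relies
  -- on this.
  choose α β hα hβ hrep using fun l => exists_displacement_coeff H.tree l
  have hs := isSmoothBddBelow_objective H.smooth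
  have hn0 : (0 : ℝ) < n := by exact_mod_cast Nat.pos_of_ne_zero (NeZero.ne n)
  have hd1 : (1 : ℝ) ≤ d := by exact_mod_cast hd
  set F := gradient (objective f) with hF
  set ζ := arrivingNoise dep f g ξ x with hζ
  set Φ := ∑ j, ‖gradient (f j) x₀‖ ^ 2
  set κ := γ * L * n with hκ_def
  have hroot : ∀ (m : ℕ) ω, aligned dep (fun t i => x t i ω) r m = x m r ω := fun m ω => by
    simp [aligned, H.tree.dep_root]
  have hpath : ∀ ω, (n : ℝ) / 2 * ∑ m ∈ Finset.range N, ‖F (x m r ω)‖ ^ 2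
      ≤ (initialGap f x₀ / γ + Φ / 2 + 20 * (d : ℝ) ^ 2 * n * L * initialGap f x₀)
        - ∑ m ∈ Finset.range N, inner ℝ (F (x m r ω)) (∑ j, ζ ω j m)
        + (κ + 100 * κ ^ 2 * (d : ℝ) ^ 3) / n * ∑ m ∈ Finset.range N, ‖∑ j, ζ ω j m‖ ^ 2
        + 3 * (γ * L) ^ 2
          * ∑ m ∈ Finset.range N, ∑ l, ‖lagSum (2 * dep l) (α l) (β l) (ζ ω) m‖ ^ 2 := by
    intro ω
    have hD := H.isDelayedDescent hdep hα hβ (fun l => hrep l _) ω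
    have key := hD.sum_sq_norm_gradient_le hL hγ hd (by rwa [Fintype.card_fin])
      (F := F) (fun u => by rw [Fintype.card_fin]; exact sum_gradient_eq H.smooth u) hs.2.2
      (φ := objective f) (φ₀ := ⨅ u, objective f u) hs.le_quadratic (ciInf_le hs.1)
      (hs.sq_norm_gradient_le hL x₀) N
    simp only [hroot, Fintype.card_fin] at key
    exact key
  have iQ : ∀ m ∈ Finset.range N, Integrable (fun ω => ‖F (x m r ω)‖ ^ 2) P := fun m _ =>
    H.integrable_sq_norm_gradient m r
  have iI : ∀ m ∈ Finset.range N, Integrable (fun ω => inner ℝ (F (x m r ω)) (∑ j, ζ ω j m)) P :=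
    fun m _ => integrable_inner_of_memLp (memLp_comp_of_lipschitz hs.2.2 hs.continuous_gradient
      ((H.memLp_state m).1 r)) (H.memLp_sum_arrivingNoise m)
  have iN : ∀ m ∈ Finset.range N, Integrable (fun ω => ‖∑ j, ζ ω j m‖ ^ 2) P := fun m _ =>
    integrable_sq_norm_of_memLp (H.memLp_sum_arrivingNoise m)
  have iW : ∀ (m : ℕ) l,
      Integrable (fun ω => ‖lagSum (2 * dep l) (α l) (β l) (ζ ω) m‖ ^ 2) P := fun m l =>
    integrable_sq_norm_of_memLp (H.integral_sq_norm_lagSum_le _ (hα l) (hβ l) m).1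
  have iW' : ∀ m ∈ Finset.range N,
      Integrable (fun ω => ∑ l, ‖lagSum (2 * dep l) (α l) (β l) (ζ ω) m‖ ^ 2) P := fun m _ =>
    integrable_finsetSum _ fun l _ => iW m l
  have hint := integral_le_of_le_combination ((integrable_finsetSum _ iQ).const_mul ((n : ℝ) / 2))
    (integrable_finsetSum _ iI) (integrable_finsetSum _ iN) (integrable_finsetSum _ iW') hpath
  rw [integral_const_mul, integral_finsetSum _ iQ, integral_finsetSum _ iI,
    integral_finsetSum _ iN, integral_finsetSum _ iW'] at hint
  refine hint.trans ?_
  have e1 : ∑ m ∈ Finset.range N, ∫ ω, inner ℝ (F (x m r ω)) (∑ j, ζ ω j m) ∂P = 0 :=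
    Finset.sum_eq_zero fun m _ =>
      H.integral_inner_sum_arrivingNoise hs.2.2 hs.continuous_gradient m
  have e2 : ∑ m ∈ Finset.range N, ∫ ω, ‖∑ j, ζ ω j m‖ ^ 2 ∂P ≤ N * (n * σ ^ 2) := by
    refine (Finset.sum_le_sum fun (m : ℕ) _ =>
      H.integral_sq_norm_sum_arrivingNoise_le (m : ℤ)).trans ?_
    simp
  have e3 : ∑ m ∈ Finset.range N, ∫ ω, ∑ l, ‖lagSum (2 * dep l) (α l) (β l) (ζ ω) m‖ ^ 2 ∂P
      ≤ N * (n * (36 * n * d * σ ^ 2)) := by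
    have hl : ∀ (m : ℕ) l, ∫ ω, ‖lagSum (2 * dep l) (α l) (β l) (ζ ω) m‖ ^ 2 ∂P
        ≤ 36 * n * d * σ ^ 2 := fun m l => by
      refine (H.integral_sq_norm_lagSum_le _ (hα l) (hβ l) m).2.trans ?_
      have : (dep l : ℝ) ≤ 2 * d := by exact_mod_cast hdep l
      rw [Fintype.card_fin]
      push_cast
      calc 9 * (n : ℝ) * (2 * dep l) * σ ^ 2 ≤ 9 * (n : ℝ) * (2 * (2 * d)) * σ ^ 2 := by gcongr
        _ = _ := by ring
    refine (Finset.sum_le_sum fun m _ => (integral_finsetSum _ fun l _ => iW m l).le.trans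
      (Finset.sum_le_sum fun l _ => hl m l)).trans ?_
    simp
  rw [e1, sub_zero]
  have e4 : (κ + 100 * κ ^ 2 * (d : ℝ) ^ 3) / n
        * ∑ m ∈ Finset.range N, ∫ ω, ‖∑ j, ζ ω j m‖ ^ 2 ∂P
      ≤ (κ + 100 * κ ^ 2 * (d : ℝ) ^ 3) / n * (N * (n * σ ^ 2)) := by
    gcongr
  have e5 : 3 * (γ * L) ^ 2 * ∑ m ∈ Finset.range N,
        ∫ ω, ∑ l, ‖lagSum (2 * dep l) (α l) (β l) (ζ ω) m‖ ^ 2 ∂P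
      ≤ 3 * (γ * L) ^ 2 * (N * (n * (36 * n * (d : ℝ) ^ 3 * σ ^ 2))) := by
    refine mul_le_mul_of_nonneg_left (e3.trans ?_) (by positivity)
    gcongr
    exact le_self_pow₀ hd1 (by norm_num)
  -- Here `208 = 100 + 3 * 36`, once the factor `d` of the window noise has been relaxed to `d ^ 3`.
  have e6 : (κ + 100 * κ ^ 2 * (d : ℝ) ^ 3) / n * (N * (n * σ ^ 2))
      + 3 * (γ * L) ^ 2 * (N * (n * (36 * n * (d : ℝ) ^ 3 * σ ^ 2)))
      = N * σ ^ 2 * (κ + 208 * κ ^ 2 * (d : ℝ) ^ 3) := by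
    rw [hκ_def]
    field_simp
    ring
  linarith

end Rate

/-! ### The stepsize -/

theorem rpow_one_div_pow {a : ℝ} (ha : 0 ≤ a) {k : ℕ} (hk : k ≠ 0) :
    (a ^ ((1 : ℝ) / k)) ^ k = a := by
  rw [one_div]
  exact Real.rpow_inv_natCast_pow ha hk

/-- The second rate, `(σ² L² Δ²)^(1/3) / (√n N)^(2/3)`, has third power `σ² L² Δ² / (n N²)`. -/
theorem cube_networkRate {Δ σ L n N : ℝ} (hn : 0 ≤ n) (hN : 0 ≤ N) :
    ((σ ^ 2 * L ^ 2 * Δ ^ 2) ^ ((1 : ℝ) / 3) / (√n * N) ^ ((2 : ℝ) / 3)) ^ 3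
      = σ ^ 2 * L ^ 2 * Δ ^ 2 / (n * N ^ 2) := by
  have h1 := rpow_one_div_pow (a := σ ^ 2 * L ^ 2 * Δ ^ 2) (by positivity) three_ne_zero
  push_cast at h1
  have h2 : ((√n * N) ^ ((2 : ℝ) / 3)) ^ 3 = n * N ^ 2 := by
    rw [← Real.rpow_natCast, ← Real.rpow_mul (by positivity)]
    norm_num
    rw [mul_pow, Real.sq_sqrt hn]
  rw [div_pow, h1, h2]

theorem sq_sgdRate {Δ σ L n N : ℝ} (hΔ : 0 ≤ Δ) (hL : 0 ≤ L) (hn : 0 ≤ n) (hN : 0 ≤ N) :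
    (√(Δ * σ ^ 2 * L) / √(n * N)) ^ 2 = Δ * σ ^ 2 * L / (n * N) := by
  rw [div_pow, Real.sq_sqrt (by positivity), Real.sq_sqrt (by positivity)]

theorem one_div_min_le {a b : ℝ} (ha : 0 < a) (hb : 0 < b) :
    1 / min a b ≤ 1 / a + 1 / b := by
  have h1 : 0 < 1 / a := by positivity
  have h2 : 0 < 1 / b := by positivity
  rcases min_choice a b with h | h <;> rw [h] <;> linarith

/-- The entry `a₁` balances `Δ / γ` against the noise of order `γ`. Comparing squares reduces both
claims to numbers, such as `3 ≤ 2 ^ 2`. -/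
theorem sgd_stepsize_bounds {Δ σ L n N a₁ s : ℝ} (hΔ : 0 < Δ) (hσ : 0 < σ) (hL : 0 < L)
    (hn0 : 0 < n) (hN0 : 0 < N) (h1 : 0 < a₁) (hs0 : 0 ≤ s)
    (hp1 : a₁ ^ 2 = Δ / (3 * σ ^ 2 * L * n * N)) (hs2 : s ^ 2 = Δ * σ ^ 2 * L / (n * N)) :
    Δ / (n * N) * (1 / a₁) ≤ 2 * s ∧ a₁ * σ ^ 2 * L ≤ s := by
  constructor
  · rw [← pow_le_pow_iff_left₀ (by positivity) (by positivity) two_ne_zero]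
    have e : (Δ / (n * N) * (1 / a₁)) ^ 2 = 3 * s ^ 2 := by
      rw [mul_pow, div_pow, div_pow, hp1, hs2]
      field_simp
    rw [e, mul_pow]
    nlinarith [sq_nonneg s]
  · rw [← pow_le_pow_iff_left₀ (by positivity) (by positivity) two_ne_zero]
    have e : (a₁ * σ ^ 2 * L) ^ 2 = s ^ 2 / 3 := by
      rw [mul_pow, mul_pow, hp1, hs2]
      field_simp
    rw [e]
    nlinarith [sq_nonneg s]

/-- The entry `a₂` balances `Δ / γ` against the noise of order `γ ^ 2`. Comparing cubes leaves `1500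
≤ 12 ^ 3` and `100 ^ 3 ≤ 1500 ^ 2`. -/
theorem network_stepsize_bounds {Δ σ L n N d a₂ u : ℝ} (hΔ : 0 < Δ) (hσ : 0 < σ) (hL : 0 < L)
    (hn0 : 0 < n) (hN0 : 0 < N) (hd1 : 1 ≤ d) (h2 : 0 < a₂) (hu0 : 0 ≤ u)
    (hp2 : a₂ ^ 3 = Δ / (1500 * n ^ 2 * d ^ 6 * σ ^ 2 * L ^ 2 * N))
    (hu3 : u ^ 3 = σ ^ 2 * L ^ 2 * Δ ^ 2 / (n * N ^ 2)) :
    Δ / (n * N) * (1 / a₂) ≤ 12 * d ^ 2 * u ∧ a₂ ^ 2 * L ^ 2 * n * d ^ 3 * σ ^ 2 ≤ u / 100 := by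
  have hd0 : 0 < d := by linarith
  constructor
  · rw [← pow_le_pow_iff_left₀ (by positivity) (by positivity) three_ne_zero]
    have e : (Δ / (n * N) * (1 / a₂)) ^ 3 = 1500 * (d ^ 6 * u ^ 3) := by
      rw [mul_pow, div_pow, div_pow, hp2, hu3]
      field_simp
    have e' : (12 * d ^ 2 * u) ^ 3 = 1728 * (d ^ 6 * u ^ 3) := by ring
    rw [e, e']
    gcongr
    norm_num
  · rw [← pow_le_pow_iff_left₀ (by positivity) (by positivity) three_ne_zero]
    have e : (a₂ ^ 2 * L ^ 2 * n * d ^ 3 * σ ^ 2) ^ 3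
        = u ^ 3 / (2250000 * d ^ 3) := by
      have : (a₂ ^ 2 * L ^ 2 * n * d ^ 3 * σ ^ 2) ^ 3
          = (a₂ ^ 3) ^ 2 * (L ^ 2 * n * d ^ 3 * σ ^ 2) ^ 3 := by ring
      rw [this, hp2, hu3]
      field_simp
      norm_num
    rw [e]
    have hd3 : 1 ≤ d ^ 3 := one_le_pow₀ hd1
    rw [div_pow]
    exact div_le_div_of_nonneg_left (by positivity) (by positivity) (by linarith)

/-- The choice of the stepsize turns the bound in terms of the stepsize into the rate. -/
theorem rate_of_stepsize {Δ σ L Γ A : ℝ} {n d T : ℕ} (hΔ : 0 < Δ) (hσ : 0 < σ) (hL : 0 < L)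
    (hn : 0 < n) (hd : 1 ≤ d)
    (hA : (n : ℝ) / 2 * A ≤ Δ / stepsize Δ σ L n d T + Γ / 2 + 20 * (d : ℝ) ^ 2 * n * L * Δ
      + ((T : ℝ) + 1) * σ ^ 2 * (stepsize Δ σ L n d T * L * n
        + 208 * (stepsize Δ σ L n d T * L * n) ^ 2 * (d : ℝ) ^ 3)) :
    1 / ((T : ℝ) + 1) * A ≤ leadingTerm Δ σ L n T + remainingTerms Δ σ L Γ n d T := by
  have hn0 : (0 : ℝ) < n := by exact_mod_cast hn
  have hd1 : (1 : ℝ) ≤ d := by exact_mod_cast hd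
  have hd0 : (0 : ℝ) < d := by linarith
  set N : ℝ := (T : ℝ) + 1 with hN
  have hN0 : 0 < N := by positivity
  set a₁ : ℝ := (Δ / (3 * σ ^ 2 * L * n * N)) ^ ((1 : ℝ) / 2) with ha₁
  set a₂ : ℝ := (Δ / (1500 * (n : ℝ) ^ 2 * (d : ℝ) ^ 6 * σ ^ 2 * L ^ 2 * N)) ^ ((1 : ℝ) / 3)
    with ha₂
  set a₃ : ℝ := 1 / (100 * n * (d : ℝ) ^ 3 * L) with ha₃
  have hγ : stepsize Δ σ L n d T = min (min a₁ a₂) a₃ := rfl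
  rw [hγ] at hA
  set γ := min (min a₁ a₂) a₃ with hγ_def
  have h1 : 0 < a₁ := Real.rpow_pos_of_pos (by positivity) _
  have h2 : 0 < a₂ := Real.rpow_pos_of_pos (by positivity) _
  have h3 : 0 < a₃ := by positivity
  have h0 : 0 < γ := lt_min (lt_min h1 h2) h3
  have hγ1 : γ ≤ a₁ := (min_le_left _ _).trans (min_le_left _ _)
  have hγ2 : γ ≤ a₂ := (min_le_left _ _).trans (min_le_right _ _)
  have hinv : 1 / γ ≤ 1 / a₁ + 1 / a₂ + 1 / a₃ :=
    (one_div_min_le (lt_min h1 h2) h3).trans (add_le_add (one_div_min_le h1 h2) le_rfl)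
  have hp1 : a₁ ^ 2 = Δ / (3 * σ ^ 2 * L * n * N) := by
    have := rpow_one_div_pow (a := Δ / (3 * σ ^ 2 * L * n * N)) (by positivity) two_ne_zero
    rw [Nat.cast_ofNat] at this
    exact this
  have hp2 : a₂ ^ 3 = Δ / (1500 * (n : ℝ) ^ 2 * (d : ℝ) ^ 6 * σ ^ 2 * L ^ 2 * N) := by
    have := rpow_one_div_pow
      (a := Δ / (1500 * (n : ℝ) ^ 2 * (d : ℝ) ^ 6 * σ ^ 2 * L ^ 2 * N)) (by positivity)
      three_ne_zero
    rw [Nat.cast_ofNat] at this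
    exact this
  clear_value γ a₁ a₂ a₃
  set s := √(Δ * σ ^ 2 * L) / √(n * N) with hs
  set u := (σ ^ 2 * L ^ 2 * Δ ^ 2) ^ ((1 : ℝ) / 3) / (√n * N) ^ ((2 : ℝ) / 3) with hu
  have hs0 : 0 ≤ s := by positivity
  have hu0 : 0 ≤ u := by positivity
  have hs2 : s ^ 2 = Δ * σ ^ 2 * L / (n * N) := sq_sgdRate hΔ.le hL.le hn0.le hN0.le
  have hu3 : u ^ 3 = σ ^ 2 * L ^ 2 * Δ ^ 2 / (n * N ^ 2) := cube_networkRate hn0.le hN0.le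
  obtain ⟨b1, b2⟩ := sgd_stepsize_bounds hΔ hσ hL hn0 hN0 h1 hs0 hp1 hs2
  obtain ⟨b3, b4⟩ := network_stepsize_bounds hΔ hσ hL hn0 hN0 hd1 h2 hu0 hp2 hu3
  clear_value s u
  have b5 : Δ / (n * N) * (1 / a₃) = 100 * (d : ℝ) ^ 3 * L * Δ / N := by
    rw [ha₃]
    field_simp
  have b6 : γ * σ ^ 2 * L ≤ s := by
    refine le_trans ?_ b2
    gcongr
  have b7 : γ ^ 2 * L ^ 2 * n * (d : ℝ) ^ 3 * σ ^ 2 ≤ u / 100 := by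
    refine le_trans ?_ b4
    gcongr
  -- Scaling by `2 / (n N)` turns `Γ / 2` into the last term of the rate with coefficient exactly
  -- one; all other constants have slack.
  have hA' : 1 / N * A ≤ 2 * (Δ / (n * N) * (1 / γ)) + Γ / (n * N)
      + 40 * ((d : ℝ) ^ 2 * L * Δ / N) + 2 * (γ * σ ^ 2 * L)
      + 416 * (γ ^ 2 * L ^ 2 * n * (d : ℝ) ^ 3 * σ ^ 2) := by
    have h := mul_le_mul_of_nonneg_left hA (by positivity : 0 ≤ 2 / (n * N))
    refine le_trans (le_of_eq ?_) (h.trans (le_of_eq ?_))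
    · field_simp
    · field_simp
      ring
  have b8 : Δ / (n * N) * (1 / γ)
      ≤ Δ / (n * N) * (1 / a₁) + Δ / (n * N) * (1 / a₂) + Δ / (n * N) * (1 / a₃) := by
    rw [← mul_add, ← mul_add]
    exact mul_le_mul_of_nonneg_left hinv (by positivity)
  have b9 : (d : ℝ) ^ 2 * L * Δ / N ≤ (d : ℝ) ^ 3 * L * Δ / N := by
    gcongr
    · norm_num
  have b10 : u ≤ (d : ℝ) ^ 2 * u := le_mul_of_one_le_left hu0 (one_le_pow₀ hd1)
  have hlead : leadingTerm Δ σ L n T = 32 * s := by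
    rw [leadingTerm, mul_div_assoc, hs]
  have hrem : remainingTerms Δ σ L Γ n d T
      = 240 * ((d : ℝ) ^ 2 * u) + 800 * ((d : ℝ) ^ 3 * L * Δ / N) + Γ / (n * N) := by
    rw [remainingTerms, hu]
    ring
  have b11 : 0 ≤ (d : ℝ) ^ 3 * L * Δ / N := by positivity
  have b12 : 100 * (d : ℝ) ^ 3 * L * Δ / N = 100 * ((d : ℝ) ^ 3 * L * Δ / N) := by ring
  have b13 : 12 * (d : ℝ) ^ 2 * u = 12 * ((d : ℝ) ^ 2 * u) := by ring
  rw [b12] at b5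
  rw [b13] at b3
  rw [hlead, hrem]
  linarith

/-! ### The transient time -/

/-- Both readings of `d` give `2 ^ (d - 1) ≤ n`. With `n ≥ 2` this yields `d log 2 ≤ 2 log n`, and
`2 / log 2 < 3`. -/
theorem depth_le_log {B n d : ℕ} (hB : 2 ≤ B) (hd : d = Nat.log B n ∨ IsTreeDepth B n d)
    (hd1 : 1 ≤ d) : (d : ℝ) ≤ 3 * Real.log n := by
  have hn2 := two_le_of_depth hB hd hd1
  have hn0 : (0 : ℝ) < n := by exact_mod_cast (by omega : 0 < n)
  have hpow : 2 ^ (d - 1) ≤ n := by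
    obtain hd | hd := hd
    · calc 2 ^ (d - 1) ≤ 2 ^ d := Nat.pow_le_pow_right (by norm_num) (by omega)
        _ ≤ B ^ d := Nat.pow_le_pow_left hB d
        _ ≤ n := hd ▸ Nat.pow_log_le_self B (by omega)
    · calc 2 ^ (d - 1) ≤ B ^ (d - 1) := Nat.pow_le_pow_left hB _
        _ ≤ ∑ k ∈ Finset.range d, B ^ k :=
          Finset.single_le_sum (f := fun k => B ^ k) (by intros; positivity)
            (Finset.mem_range.2 (by omega))
        _ ≤ n := hd.1.le
  have h1 : ((d - 1 : ℕ) : ℝ) * Real.log 2 ≤ Real.log n := by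
    rw [← Real.log_pow]
    exact Real.log_le_log (by positivity) (by exact_mod_cast hpow)
  have h2 : Real.log 2 ≤ Real.log n :=
    Real.log_le_log (by norm_num) (by exact_mod_cast hn2)
  have h3 := Real.log_two_gt_d9
  rw [Nat.cast_sub hd1, Nat.cast_one] at h1
  have h4 : (d : ℝ) * Real.log 2 ≤ 2 * Real.log n := by linarith
  have h5 : (d : ℝ) * 0.6931471803 ≤ d * Real.log 2 := by gcongr
  have h6 : (0 : ℝ) ≤ d := by positivity
  linarith

theorem remainingTerms_le {Δ σ L M Γ C : ℝ} {n d T : ℕ} (hΔ : 0 < Δ) (hσ : 0 < σ) (hL : 0 < L)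
    (hM : 0 ≤ M) (hC : 0 ≤ C) (hn : 0 < n) (hd : 1 ≤ d) (hΓ : Γ ≤ M * n)
    (hT : (n : ℝ) * (d : ℝ) ^ 12 ≤ C * ((T : ℝ) + 1)) :
    remainingTerms Δ σ L Γ n d T
      ≤ (1040 * (1 + C * (L * Δ / σ ^ 2)) + M * (1 + C / (Δ * σ ^ 2 * L)))
        * leadingTerm Δ σ L n T := by
  have hn0 : (0 : ℝ) < n := by exact_mod_cast hn
  have hd1 : (1 : ℝ) ≤ d := by exact_mod_cast hd
  have hd0 : (0 : ℝ) < d := by linarith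
  set N : ℝ := (T : ℝ) + 1 with hN
  have hN0 : 0 < N := by positivity
  set s := √(Δ * σ ^ 2 * L) / √(n * N) with hs
  set u := (σ ^ 2 * L ^ 2 * Δ ^ 2) ^ ((1 : ℝ) / 3) / (√n * N) ^ ((2 : ℝ) / 3) with hu
  have hs0 : 0 ≤ s := by positivity
  have hu0 : 0 ≤ u := by positivity
  have hs2 : s ^ 2 = Δ * σ ^ 2 * L / (n * N) := sq_sgdRate hΔ.le hL.le hn0.le hN0.le
  have hu3 : u ^ 3 = σ ^ 2 * L ^ 2 * Δ ^ 2 / (n * N ^ 2) := cube_networkRate hn0.le hN0.le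
  set z := C * (L * Δ / σ ^ 2) with hz
  set z' := C / (Δ * σ ^ 2 * L) with hz'
  have hz0 : 0 ≤ z := by positivity
  have hz'0 : 0 ≤ z' := by positivity
  -- Using `1 + c` in place of a `k`-th root of `c` keeps the constant free of fractional powers.
  have hpow : ∀ {c : ℝ}, 0 ≤ c → ∀ {k : ℕ}, k ≠ 0 → c ≤ (1 + c) ^ k := fun {c} hc k hk =>
    (by linarith : c ≤ 1 + c).trans (le_self_pow₀ (by linarith) hk)
  have hT' : (n : ℝ) * (d : ℝ) ^ 12 / N ≤ C := by
    rw [div_le_iff₀ hN0]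
    exact hT
  have hT6 : (n : ℝ) * (d : ℝ) ^ 6 / N ≤ C := by
    refine le_trans ?_ hT'
    gcongr
    norm_num
  have hT0 : (n : ℝ) / N ≤ C := by
    refine le_trans ?_ hT'
    gcongr
    exact le_mul_of_one_le_right hn0.le (one_le_pow₀ hd1)
  -- Sixth powers clear the cube root in `u` and the square root in `s`. Their ratio is proportional
  -- to `n d ^ 12 / N`, the origin of the twelfth power in the transient time.
  have b1 : (d : ℝ) ^ 2 * u ≤ (1 + z) * s := by
    rw [← pow_le_pow_iff_left₀ (by positivity) (by positivity) (by norm_num : 6 ≠ 0)]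
    have e : ((d : ℝ) ^ 2 * u) ^ 6 = (n * (d : ℝ) ^ 12 / N) * (L * Δ / σ ^ 2) * s ^ 6 := by
      have e1 : ((d : ℝ) ^ 2 * u) ^ 6 = (d : ℝ) ^ 12 * (u ^ 3) ^ 2 := by ring
      have e2 : s ^ 6 = (s ^ 2) ^ 3 := by ring
      rw [e1, e2, hu3, hs2]
      field_simp
    rw [e, mul_pow]
    refine mul_le_mul_of_nonneg_right (le_trans ?_ (hpow hz0 (by norm_num))) (by positivity)
    rw [hz]
    gcongr
  have b2 : (d : ℝ) ^ 3 * L * Δ / N ≤ (1 + z) * s := by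
    rw [← pow_le_pow_iff_left₀ (by positivity) (by positivity) two_ne_zero]
    have e : ((d : ℝ) ^ 3 * L * Δ / N) ^ 2
        = (n * (d : ℝ) ^ 6 / N) * (L * Δ / σ ^ 2) * s ^ 2 := by
      rw [hs2]
      field_simp
    rw [e, mul_pow]
    refine mul_le_mul_of_nonneg_right (le_trans ?_ (hpow hz0 two_ne_zero)) (by positivity)
    rw [hz]
    gcongr
  have b3 : 1 / N ≤ (1 + z') * s := by
    rw [← pow_le_pow_iff_left₀ (by positivity) (by positivity) two_ne_zero]
    have e : (1 / N) ^ 2 = (n / N) / (Δ * σ ^ 2 * L) * s ^ 2 := by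
      rw [hs2]
      field_simp
    rw [e, mul_pow]
    refine mul_le_mul_of_nonneg_right (le_trans ?_ (hpow hz'0 two_ne_zero)) (by positivity)
    rw [hz']
    gcongr
  have b4 : Γ / (n * N) ≤ M * ((1 + z') * s) := by
    calc Γ / (n * N) ≤ M * n / (n * N) := by gcongr
      _ = M * (1 / N) := by field_simp
      _ ≤ _ := by gcongr
  have hlead : leadingTerm Δ σ L n T = 32 * s := by
    rw [leadingTerm, mul_div_assoc]
  have hrem : remainingTerms Δ σ L Γ n d T
      = 240 * ((d : ℝ) ^ 2 * u) + 800 * ((d : ℝ) ^ 3 * L * Δ / N) + Γ / (n * N) := by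
    rw [remainingTerms, hu]
    ring
  rw [hlead, hrem]
  have b5 : 0 ≤ (1 + z) * s := by positivity
  have b6 : 0 ≤ M * ((1 + z') * s) := by positivity
  have b7 : (1040 * (1 + z) + M * (1 + z')) * (32 * s)
      = 32 * (1040 * ((1 + z) * s)) + 32 * (M * ((1 + z') * s)) := by ring
  rw [b7]
  linarith

theorem exists_transient_bound (Δ σ L M c : ℝ) (hΔ : 0 < Δ) (hσ : 0 < σ) (hL : 0 < L)
    (hM : 0 ≤ M) (hc : 0 < c) :
    ∃ K : ℝ, 0 < K ∧ ∀ (B n d T : ℕ) (Γ : ℝ), 2 ≤ B →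
      (d = Nat.log B n ∨ IsTreeDepth B n d) → 1 ≤ d → Γ ≤ M * n →
      c * (n * Real.log n ^ 12) ≤ T →
      remainingTerms Δ σ L Γ n d T ≤ K * leadingTerm Δ σ L n T := by
  refine ⟨_, ?_, fun B n d T Γ hB hd hd1 hΓ hT =>
    remainingTerms_le (C := 3 ^ 12 / c) hΔ hσ hL hM (by positivity)
      (by have := two_le_of_depth hB hd hd1; omega) hd1 hΓ ?_⟩
  · positivity
  · have h1 := pow_le_pow_left₀ (by positivity) (depth_le_log hB hd hd1) 12
    calc (n : ℝ) * (d : ℝ) ^ 12 ≤ n * (3 * Real.log n) ^ 12 := by gcongr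
      _ = 3 ^ 12 / c * (c * (n * Real.log n ^ 12)) := by
        field_simp
      _ ≤ 3 ^ 12 / c * ((T : ℝ) + 1) := by
        gcongr
        linarith

/-! ### The `B`-ary tree instance -/

section Tree

variable {n B : ℕ}

theorem isPushPull_iterates {E : Type*} [AddCommGroup E] [Module ℝ E] {Ξ : Fin n → Type*}
    (hB : 2 ≤ B) (γ : ℝ) (x₀ : E) (g : ∀ i, E → Ξ i → E) (s : ℕ → ∀ i, Ξ i) :
    IsPushPull (treeParent B) γ x₀ (fun t i => g i ((iterates B γ x₀ g s t).1 i) (s t i))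
      (fun t i => (iterates B γ x₀ g s t).1 i) (fun t i => (iterates B γ x₀ g s t).2 i) where
  x_zero _ := rfl
  x_succ t i := by
    simp [iterates, pullIn_eq hB]
  y_zero _ := rfl
  y_succ t i := by
    simp [iterates, pushIn_eq hB]

theorem iterates_zero_stepsize {E : Type*} [AddCommGroup E] [Module ℝ E] {Ξ : Fin n → Type*}
    (hB : 2 ≤ B) (x₀ : E) (g : ∀ i, E → Ξ i → E) (s : ℕ → ∀ i, Ξ i) (t : ℕ) (i : Fin n) :
    (iterates B 0 x₀ g s t).1 i = x₀ := by
  induction t generalizing i with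
  | zero => rfl
  | succ t ih =>
    rw [(isPushPull_iterates hB 0 x₀ g s).x_succ, ih, zero_smul, sub_zero]

end Tree

theorem rate_nonneg {Δ σ L Γ : ℝ} (hΔ : 0 ≤ Δ) (hL : 0 ≤ L) (hΓ : 0 ≤ Γ) (n d T : ℕ) :
    0 ≤ leadingTerm Δ σ L n T + remainingTerms Δ σ L Γ n d T := by
  rw [leadingTerm, remainingTerms]
  positivity

/-- With zero initial gap the method stands still, so this case needs a separate argument. -/
theorem stepsize_zero_gap (σ L : ℝ) (hL : 0 < L) (n d T : ℕ) : stepsize 0 σ L n d T = 0 := by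
  rw [stepsize, zero_div, zero_div, Real.zero_rpow (by norm_num), Real.zero_rpow (by norm_num),
    min_self]
  exact min_eq_left (by positivity)

theorem stepsize_pos {Δ σ L : ℝ} {n d : ℕ} (hΔ : 0 < Δ) (hσ : 0 < σ) (hL : 0 < L) (hn : 0 < n)
    (hd : 1 ≤ d) (T : ℕ) : 0 < stepsize Δ σ L n d T := by
  have hn0 : (0 : ℝ) < n := by exact_mod_cast hn
  have hd0 : (0 : ℝ) < d := by exact_mod_cast hd
  exact lt_min (lt_min (Real.rpow_pos_of_pos (by positivity) _)
    (Real.rpow_pos_of_pos (by positivity) _)) (by positivity)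

theorem stepsize_mul_le {L : ℝ} {n d : ℕ} (Δ σ : ℝ) (hL : 0 < L) (hn : 0 < n)
    (hd : 1 ≤ d) (T : ℕ) : 100 * (stepsize Δ σ L n d T * L * n) * (d : ℝ) ^ 3 ≤ 1 := by
  have hn0 : (0 : ℝ) < n := by exact_mod_cast hn
  have hd0 : (0 : ℝ) < d := by exact_mod_cast hd
  have h : stepsize Δ σ L n d T ≤ 1 / (100 * n * (d : ℝ) ^ 3 * L) := min_le_right _ _
  rw [le_div_iff₀ (by positivity)] at h
  linarith

end BTPP

/-! ### The main theorem. -/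

theorem theorem1 :
    -- the convergence rate
    (∀ {Ω : Type*} [MeasurableSpace Ω] (P : Measure Ω) [IsProbabilityMeasure P]
      (p n B d T : ℕ) [NeZero n] (_hB : 2 ≤ B)
      (_hd : d = Nat.log B n ∨ BTPP.IsTreeDepth B n d) (_hd1 : 1 ≤ d)
      (L σ : ℝ) (_hL : 0 < L) (_hσ : 0 < σ)
      (f : Fin n → EuclideanSpace ℝ (Fin p) → ℝ) (_hf : ∀ i, BTPP.IsSmoothBddBelow L (f i))
      (Ξ : Fin n → Type*) [∀ i, MeasurableSpace (Ξ i)]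
      (D : ∀ i, Measure (Ξ i)) [∀ i, IsProbabilityMeasure (D i)]
      (g : ∀ i, EuclideanSpace ℝ (Fin p) → Ξ i → EuclideanSpace ℝ (Fin p))
      (_hg : ∀ i, BTPP.IsUnbiasedOracle (D i) σ (f i) (g i))
      (ξ : ∀ (t : ℕ) (i : Fin n), Ω → Ξ i) (_hξm : ∀ t i, Measurable (ξ t i))
      (_hξD : ∀ t i, P.map (ξ t i) = D i)
      (_hξ : iIndepFun (fun q : ℕ × Fin n => ξ q.1 q.2) P)
      (x₀ : EuclideanSpace ℝ (Fin p)) (γ : ℝ)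
      (_hγ : γ = BTPP.stepsize (BTPP.initialGap f x₀) σ L n d T)
      (x₁ : ℕ → Ω → EuclideanSpace ℝ (Fin p))
      (_hx₁ : ∀ t ω, x₁ t ω = (BTPP.iterates B γ x₀ g (fun τ i => ξ τ i ω) t).1 0),
      (∀ t ≤ T, Integrable (fun ω => ‖gradient (BTPP.objective f) (x₁ t ω)‖ ^ 2) P) ∧
      1 / ((T : ℝ) + 1) *
          ∑ t ∈ Finset.range (T + 1), ∫ ω, ‖gradient (BTPP.objective f) (x₁ t ω)‖ ^ 2 ∂P
        ≤ BTPP.leadingTerm (BTPP.initialGap f x₀) σ L n T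
          + BTPP.remainingTerms (BTPP.initialGap f x₀) σ L
              (∑ i, ‖gradient (f i) x₀‖ ^ 2) n d T) ∧
    -- the transient time is `O(n (log n)^12)`: from then on the leading term of the rate
    -- dominates the others up to a factor `K` that does not depend on `B`, `n`, `d`, `T`
    (∀ Δ σ L M c : ℝ, 0 < Δ → 0 < σ → 0 < L → 0 ≤ M → 0 < c →
      ∃ K : ℝ, 0 < K ∧ ∀ (B n d T : ℕ) (Γ : ℝ), 2 ≤ B →
        (d = Nat.log B n ∨ BTPP.IsTreeDepth B n d) → 1 ≤ d → Γ ≤ M * n →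
        c * (n * Real.log n ^ 12) ≤ T →
        BTPP.remainingTerms Δ σ L Γ n d T ≤ K * BTPP.leadingTerm Δ σ L n T) := by
  refine ⟨?_, BTPP.exists_transient_bound⟩
  intro Ω _ P _ p n B d T _ hB hd hd1 L σ hL hσ f hf Ξ _ D _ g hg ξ hξm hξD hξ x₀ γ hγ x₁ hx₁
  have hn : 0 < n := Nat.pos_of_ne_zero (NeZero.ne n)
  set x : ℕ → Fin n → Ω → EuclideanSpace ℝ (Fin p) := fun t i ω =>
    (BTPP.iterates B γ x₀ g (fun τ i => ξ τ i ω) t).1 i with hx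
  set y : ℕ → Fin n → Ω → EuclideanSpace ℝ (Fin p) := fun t i ω =>
    (BTPP.iterates B γ x₀ g (fun τ i => ξ τ i ω) t).2 i with hy
  have H : BTPP.IsStochasticPushPull P L σ γ (0 : Fin n) (BTPP.treeParent B)
      (fun i => BTPP.treeDepth B i) f g D ξ x₀ x y :=
    { tree := BTPP.isRootedTree_treeParent B
      smooth := hf
      oracle := hg
      measurable_sample := hξm
      law := hξD
      indep := hξ
      recursion := fun ω => BTPP.isPushPull_iterates hB γ x₀ g fun τ i => ξ τ i ω }
  have hx₁' : ∀ t, x₁ t = x t 0 := fun t => funext fun ω => hx₁ t ω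
  refine ⟨fun t _ => hx₁' t ▸ H.integrable_sq_norm_gradient t 0, ?_⟩
  simp only [hx₁']
  -- If the gap is zero, `x₀` is a minimizer and the stepsize vanishes: every iterate equals `x₀`,
  -- where the gradient is zero. Division by `γ` is possible only in the other case.
  obtain hΔ | hΔ := (BTPP.initialGap_nonneg (x₀ := x₀) hf).eq_or_lt
  · have hγ0 : γ = 0 := by rw [hγ, ← hΔ, BTPP.stepsize_zero_gap σ L hL]
    have hgrad : ‖gradient (BTPP.objective f) x₀‖ ^ 2 = 0 := by
      refine le_antisymm ?_ (sq_nonneg _)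
      have h := (BTPP.isSmoothBddBelow_objective hf).sq_norm_gradient_le hL x₀
      rw [BTPP.initialGap] at hΔ
      rwa [← hΔ, mul_zero] at h
    have hconst : ∀ t ω, x t 0 ω = x₀ := fun t ω => by
      simp only [hx, hγ0]
      exact BTPP.iterates_zero_stepsize hB x₀ g _ t 0
    simp only [hconst, hgrad, integral_zero, Finset.sum_const_zero, mul_zero]
    exact BTPP.rate_nonneg hΔ.le hL.le (Finset.sum_nonneg fun i _ => sq_nonneg _) n d T
  · refine BTPP.rate_of_stepsize hΔ hσ hL hn hd1 ?_
    have h := H.sum_integral_sq_norm_gradient_le hL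
      (hγ ▸ BTPP.stepsize_pos hΔ hσ hL hn hd1 T) hd1 (fun j => BTPP.treeDepth_le_two_mul hB hd hd1 j)
      (hγ ▸ BTPP.stepsize_mul_le _ σ hL hn hd1 T) (T + 1)
    rw [← hγ]
    rw [Nat.cast_succ] at h
    exact h
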